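/- Let $b\ge 2$ and $r>1$ be integers. Let $k\ge 1$ be an integer with base $b$ expansion $k=\kappa_1b^{a_1-1}+\cdots+\kappa_vb^{a_v-1}$, where $v\ge1$, $0<\kappa_1,\dots,\kappa_v<b$ and $a_1>\cdots>a_v>0$. For $x\in[0,1)$ with base $b$ expansion $x=x_1/b+x_2/b^2+\cdots$ (infinitely many $x_i\ne b-1$), let $\mathrm{wal}_k(x)=\omega_b^{\kappa_1x_{a_1}+\cdots+\kappa_vx_{a_v}}$ with $\omega_b=e^{2\pi \mathrm{i}/b}$, and for $f:[0,1]\to\mathbb R$ let $\hat f(k)=\int_0^1 f(x)\overline{\mathrm{wal}_k(x)}\,\mathrm dx$. Let $\mu_{0,\mathrm{per}}(k)=0$ and, for $s\ge1$, $$\mu_{s,\mathrm{per}}(k)=\begin{cases}a_1+\cdots+a_v+(s-v)a_v & \text{if } 1\le v<s,\\ a_1+\cdots+a_s & \text{if } v\ge s.\end{cases}$$ Let $\mathcal H_r$ be the unanchored Sobolev space of all functions $f:[0,1]\to\mathbb R$ such that $f,f',\dots,f^{(r-1)}$ exist and are absolutely continuous on $[0,1]$ and $f^{(r)}\in L^2([0,1])$.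 It is a reproducing kernel Hilbert space with inner product $\langle f,g\rangle_r=\sum_{s=0}^{r-1}\int_0^1f^{(s)}\,\mathrm dx\int_0^1g^{(s)}\,\mathrm dx+\int_0^1f^{(r)}g^{(r)}\,\mathrm dx$. Then for all $f\in\mathcal H_r$ $$\begin{aligned}|\hat f(k)|\le{}&\sum_{s=v}^r\left|\int_0^1f^{(s)}(x)\,\mathrm dx\right|\frac{b^{-\mu_{s,\mathrm{per}}(k)}}{(2\sin\frac{\pi}{b})^s}\left(1+\frac1b+\frac1{b(b+1)}\right)^{\max(0,s-2)}\\&+\int_0^1|f^{(r)}(x)|\,\mathrm dx\;\frac{2b^{-\mu_{r,\mathrm{per}}(k)}}{(2\sin\frac{\pi}{b})^r}\left(1+\frac1b+\frac1{b(b+1)}\right)^{r-2}\left(3+\frac2b+\frac{2b+1}{b-1}\right),\end{aligned}$$ where for $v>r$ the empty sum $\sum_{s=v}^r$ is $0$. -/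

import Mathlib

open MeasureTheory Set

/-- The coefficient of `b ^ (a - 1)` (`a ≥ 1`) in the base `b` expansion of the natural number `k`. -/
def natDigit (b k a : ℕ) : ℕ := k / b ^ (a - 1) % b

/-- The exponents `a` for which `b ^ (a - 1)` occurs with a nonzero coefficient in the base `b`
expansion of `k`, i.e. the set `{a₁, …, aᵥ}` when `k = κ₁ b ^ (a₁ - 1) + ⋯ + κᵥ b ^ (aᵥ - 1)` with
`0 < κᵢ < b`.  The range `1 ≤ a ≤ k` is large enough, since `b ^ (a - 1) ≤ k` forces `a ≤ k`
when `b ≥ 2`. -/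
def digitPositions (b k : ℕ) : Finset ℕ :=
  (Finset.Icc 1 k).filter fun a => natDigit b k a ≠ 0

/-- The list `[a₁, …, aᵥ]` of these exponents in decreasing order `a₁ > ⋯ > aᵥ > 0`. -/
def positionList (b k : ℕ) : List ℕ := (digitPositions b k).sort (· ≥ ·)

/-- The number `v` of nonzero base `b` digits of `k`. -/
def numNonzeroDigits (b k : ℕ) : ℕ := (digitPositions b k).card

/-- `μ_{r,per}(k)`: it is `0` if `r = 0` or `k = 0`, it is `a₁ + ⋯ + aᵥ + (r - v) aᵥ` if
`1 ≤ v < r`, and `a₁ + ⋯ + a_r` if `v ≥ r`. -/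
def muPer (b r k : ℕ) : ℕ :=
  if r = 0 ∨ k = 0 then 0
  else if numNonzeroDigits b k < r then
    (positionList b k).sum + (r - numNonzeroDigits b k) * (positionList b k).getLastD 0
  else ((positionList b k).take r).sum

noncomputable section

/-- The `a`-th digit `x_a` (`a ≥ 1`) of `x ∈ [0, 1)` in the base `b` expansion
`x = x₁ / b + x₂ / b ^ 2 + ⋯` in which infinitely many digits differ from `b - 1`. -/
def realDigit (b : ℕ) (x : ℝ) (a : ℕ) : ℕ := ⌊x * (b : ℝ) ^ a⌋₊ % b

/-- The `k`-th Walsh function in base `b`, with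
`wal_k(x) = ω_b ^ (κ₁ x_{a₁} + ⋯ + κᵥ x_{aᵥ})`, `ω_b = exp (2 π i / b)`; `wal_0 = 1`. -/
def walsh (b k : ℕ) (x : ℝ) : ℂ :=
  Complex.exp (2 * Real.pi * Complex.I / b) ^
    (∑ a ∈ digitPositions b k, natDigit b k a * realDigit b x a)

/-- The `k`-th Walsh coefficient `∫₀¹ f(x) conj (wal_k(x)) dx` of `f : [0, 1] → ℝ`. -/
def walshCoeff (b : ℕ) (f : ℝ → ℝ) (k : ℕ) : ℂ :=
  ∫ x in (0 : ℝ)..1, (f x : ℂ) * (starRingEnd ℂ) (walsh b k x)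

/-- The `s`-th derivative of `f` on `[0, 1]`, one-sided at the end points.  For `f` in the Sobolev
space of order `r` this is the classical derivative for `s < r`, and for `s = r` it is the
derivative of `f^{(r-1)}`, which exists almost everywhere. -/
def unitDeriv (s : ℕ) (f : ℝ → ℝ) : ℝ → ℝ := iteratedDerivWithin s f (Icc 0 1)

/-- The unanchored Sobolev space `H_r` (`r ≥ 1`) of functions on `[0, 1]`: `f` is `r - 1` times
continuously differentiable on `[0, 1]`, `f^{(r-1)}` is absolutely continuous there, and
`f^{(r)} ∈ L²([0, 1])`.  Only the values of `f` on `[0, 1]` matter. -/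
structure MemSobolev (r : ℕ) (f : ℝ → ℝ) : Prop where
  contDiffOn : ContDiffOn ℝ ((r - 1 : ℕ) : WithTop ℕ∞) f (Icc 0 1)
  absolutelyContinuous : AbsolutelyContinuousOnInterval (unitDeriv (r - 1) f) 0 1
  memLp : MemLp (unitDeriv r f) 2 (volume.restrict (Icc 0 1))

end

/-!
Write `k = κ b ^ n + m` with `0 < κ < b` and `m < b ^ n`, and let `B` be the operator
`centredPrimitive` that sends `h` to the primitive of `h - ∫₀¹ h` vanishing at `0` and `1`.
Integrating by parts `r` times (`MemSobolev.integral_smul_eq_sum`) gives, with `W` the conjugate of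
the `k`-th Walsh function,
`∫ f W = ∑_{s ≤ r} (-1) ^ s (∫ f^(s)) (∫ B ^ s W) + (-1) ^ r ∫ f^(r) (B ^ r W - ∫ B ^ r W)`,
so it remains to bound the means of `B ^ s W` and the oscillation of `B ^ r W`.  Up to sign, these
are the Walsh coefficients of Bernoulli polynomials and of shifted periodic Bernoulli functions,
but only the operator `B` is needed.

The primitive of `W` is explicit: it involves `W`, the Walsh function of
index `m`, and the sawtooth function `{b ^ (n + 1) x} - 1 / 2`.  Expanding the latter in base `b`,
and each centred digit in characters of `ℤ / b` (`digit_sub_eq_sum`), expresses `B W` through the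
Walsh functions of indices `m`, `k` and `θ b ^ (n + 1 + c) + k`
(`integral_conjWalsh_expansion`).  Hence any linear functional `L` that is bounded in the supremum
norm on `[0, 1]` satisfies a recursive estimate for `L (B W)`
(`norm_apply_centredPrimitive_walshFun_le`).

The exponent `muPer` is adapted to this recursion: `muPer b (s + 1) k = n + 1 + muPer b s m` if
`m ≠ 0`, while passing from `s` to `s + 1` at fixed `k` raises it by at most `n + 1`, and by at most
`n` if `m ≠ 0` and `s ≥ 1`.  One application of `B` therefore multiplies the constant by
`1 / (2 sin (π / b))` and by `1 + 1 / b + 1 / (b (b + 1))`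
(`norm_apply_centredPrimitive_le_of_muPer`).  For the means the second factor only enters after
the second step, since many of the contributing terms vanish
(`meanUnit_pow_centredPrimitive_eq_zero`).
-/

/-! ### Leading digits and the exponents `muPer` -/

theorem natDigit_lead {b κ n m : ℕ} (hκ : κ < b) (hm : m < b ^ n) :
    natDigit b (κ * b ^ n + m) (n + 1) = κ := by
  have hb : 0 < b := by omega
  rw [natDigit, Nat.add_sub_cancel, add_comm, Nat.add_mul_div_right _ _ (pow_pos hb n),
    Nat.div_eq_of_lt hm, zero_add, Nat.mod_eq_of_lt hκ]

theorem natDigit_tail {b n a : ℕ} (κ m : ℕ) (hb : 0 < b) (ha : 1 ≤ a) (han : a ≤ n) :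
    natDigit b (κ * b ^ n + m) a = natDigit b m a := by
  obtain ⟨d, rfl⟩ : ∃ d, n = (a - 1) + (d + 1) := ⟨n - a, by omega⟩
  rw [natDigit, natDigit, add_comm,
    show κ * b ^ (a - 1 + (d + 1)) = (κ * b ^ d * b) * b ^ (a - 1) by ring,
    Nat.add_mul_div_right _ _ (pow_pos hb _), Nat.add_mul_mod_self_right]

theorem natDigit_eq_zero {b k n a : ℕ} (hb : 0 < b) (hk : k < b ^ n) (ha : n < a) :
    natDigit b k a = 0 := by
  rw [natDigit, Nat.div_eq_of_lt (hk.trans_le (Nat.pow_le_pow_right hb (by omega))), Nat.zero_mod]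

theorem mem_digitPositions {b k a : ℕ} (hb : 2 ≤ b) :
    a ∈ digitPositions b k ↔ 1 ≤ a ∧ natDigit b k a ≠ 0 := by
  simp only [digitPositions, Finset.mem_filter, Finset.mem_Icc]
  refine ⟨fun h => ⟨h.1.1, h.2⟩, fun h => ⟨⟨h.1, ?_⟩, h.2⟩⟩
  by_contra! hlt
  exact h.2 (natDigit_eq_zero (by omega) (Nat.lt_pow_self (by omega : 1 < b)) hlt)

theorem le_of_mem_digitPositions {b k n a : ℕ} (hb : 2 ≤ b) (hk : k < b ^ n)
    (ha : a ∈ digitPositions b k) : a ≤ n := by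
  by_contra! hlt
  exact ((mem_digitPositions hb).1 ha).2 (natDigit_eq_zero (by omega) hk hlt)

theorem lead_lt_pow {b κ n m : ℕ} (hκ : κ < b) (hm : m < b ^ n) : κ * b ^ n + m < b ^ (n + 1) :=
  calc κ * b ^ n + m < κ * b ^ n + b ^ n := by omega
    _ = (κ + 1) * b ^ n := by ring
    _ ≤ b * b ^ n := Nat.mul_le_mul_right _ hκ
    _ = b ^ (n + 1) := by ring

theorem digitPositions_lead {b κ n m : ℕ} (hb : 2 ≤ b) (hκ0 : 0 < κ) (hκ : κ < b)
    (hm : m < b ^ n) :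
    digitPositions b (κ * b ^ n + m) = insert (n + 1) (digitPositions b m) := by
  ext a
  rw [Finset.mem_insert, mem_digitPositions hb, mem_digitPositions hb]
  rcases lt_trichotomy a (n + 1) with h | h | h
  · constructor
    · rintro ⟨h1, h2⟩
      rw [natDigit_tail _ _ (by omega) h1 (by omega)] at h2
      exact Or.inr ⟨h1, h2⟩
    · rintro (h1 | ⟨h1, h2⟩)
      · omega
      · rw [natDigit_tail _ _ (by omega) h1 (by omega)]
        exact ⟨h1, h2⟩
  · subst h
    rw [natDigit_lead hκ hm]
    simp [hκ0.ne']
  · rw [natDigit_eq_zero (by omega) (lead_lt_pow hκ hm) h,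
      natDigit_eq_zero (by omega) hm (by omega : n < a)]
    simp [h.ne']

theorem succ_notMem_digitPositions {b n m : ℕ} (hb : 2 ≤ b) (hm : m < b ^ n) :
    n + 1 ∉ digitPositions b m := fun h => by
  have := le_of_mem_digitPositions hb hm h
  omega

theorem positionList_lead {b κ n m : ℕ} (hb : 2 ≤ b) (hκ0 : 0 < κ) (hκ : κ < b)
    (hm : m < b ^ n) :
    positionList b (κ * b ^ n + m) = (n + 1) :: positionList b m := by
  rw [positionList, digitPositions_lead hb hκ0 hκ hm, Finset.sort_insert]
  · rfl
  · intro a ha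
    have := le_of_mem_digitPositions hb hm ha
    show n + 1 ≥ a
    omega
  · exact succ_notMem_digitPositions hb hm

theorem numNonzeroDigits_lead {b κ n m : ℕ} (hb : 2 ≤ b) (hκ0 : 0 < κ) (hκ : κ < b)
    (hm : m < b ^ n) :
    numNonzeroDigits b (κ * b ^ n + m) = numNonzeroDigits b m + 1 := by
  rw [numNonzeroDigits, digitPositions_lead hb hκ0 hκ hm,
    Finset.card_insert_of_notMem (succ_notMem_digitPositions hb hm)]
  rfl

theorem exists_lead {b k : ℕ} (hb : 2 ≤ b) (hk : k ≠ 0) :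
    ∃ κ n m, 0 < κ ∧ κ < b ∧ m < b ^ n ∧ k = κ * b ^ n + m := by
  have hpos : 0 < b ^ Nat.log b k := pow_pos (by omega) _
  refine ⟨k / b ^ Nat.log b k, Nat.log b k, k % b ^ Nat.log b k,
    Nat.div_pos (Nat.pow_log_le_self b hk) hpos, ?_, Nat.mod_lt _ hpos, ?_⟩
  · rw [Nat.div_lt_iff_lt_mul hpos, mul_comm, ← pow_succ]
    exact Nat.lt_pow_succ_log_self (by omega) k
  · rw [mul_comm, Nat.div_add_mod]

/-- Induction over the base `b` digits of a number, adding a new leading digit at each step. -/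
theorem lead_induction {b : ℕ} (hb : 2 ≤ b) {P : ℕ → Prop} (zero : P 0)
    (lead : ∀ κ n m, 0 < κ → κ < b → m < b ^ n → P m → P (κ * b ^ n + m)) (k : ℕ) : P k := by
  induction k using Nat.strong_induction_on with
  | _ k ih =>
    rcases eq_or_ne k 0 with rfl | hk
    · exact zero
    · obtain ⟨κ, n, m, h0, h1, h2, rfl⟩ := exists_lead hb hk
      refine lead κ n m h0 h1 h2 (ih m ?_)
      have : 0 < κ * b ^ n := Nat.mul_pos h0 (pow_pos (by omega) _)
      omega

theorem digitPositions_zero (b : ℕ) : digitPositions b 0 = ∅ := by simp [digitPositions]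

theorem numNonzeroDigits_zero (b : ℕ) : numNonzeroDigits b 0 = 0 := by
  simp [numNonzeroDigits, digitPositions_zero]

theorem positionList_zero (b : ℕ) : positionList b 0 = [] := by
  simp [positionList, digitPositions_zero]

theorem lead_ne_zero {b κ n m : ℕ} (hκ0 : 0 < κ) (hκ : κ < b) : κ * b ^ n + m ≠ 0 := by
  have : 0 < κ * b ^ n := Nat.mul_pos hκ0 (pow_pos (by omega) _)
  omega

theorem muPer_zero_left (b k : ℕ) : muPer b 0 k = 0 := by simp [muPer]

theorem muPer_lead {b κ n m : ℕ} (hb : 2 ≤ b) (hκ0 : 0 < κ) (hκ : κ < b) (hm : m < b ^ n)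
    (hm0 : m ≠ 0) (s : ℕ) :
    muPer b (s + 1) (κ * b ^ n + m) = (n + 1) + muPer b s m := by
  have hlist : positionList b m ≠ [] := by
    obtain ⟨κ', n', m', h0, h1, h2, rfl⟩ := exists_lead hb hm0
    rw [positionList_lead hb h0 h1 h2]
    exact List.cons_ne_nil _ _
  simp only [muPer, positionList_lead hb hκ0 hκ hm, numNonzeroDigits_lead hb hκ0 hκ hm,
    lead_ne_zero hκ0 hκ, hm0, or_false]
  rcases s with _ | s
  · simp
  · obtain ⟨x, l, hxl⟩ := List.exists_cons_of_ne_nil hlist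
    simp only [hxl]
    split_ifs <;> first | omega | simp [add_assoc]

theorem muPer_lead_zero {b κ n : ℕ} (hb : 2 ≤ b) (hκ0 : 0 < κ) (hκ : κ < b) (s : ℕ) :
    muPer b s (κ * b ^ n + 0) = s * (n + 1) := by
  have hm : 0 < b ^ n := pow_pos (by omega) _
  simp only [muPer, positionList_lead hb hκ0 hκ hm, numNonzeroDigits_lead hb hκ0 hκ hm,
    lead_ne_zero hκ0 hκ, or_false, positionList_zero, numNonzeroDigits_zero]
  rcases s with _ | _ | s
  · simp
  · simp
  · simp
    ring

theorem muPer_succ_le {b : ℕ} (hb : 2 ≤ b) (k : ℕ) :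
    ∀ n s, k ≠ 0 → k < b ^ n → muPer b (s + 1) k ≤ muPer b s k + n := by
  induction k using lead_induction hb with
  | zero => intro n s h; exact absurd rfl h
  | lead κ n m h0 h1 h2 ih =>
    intro N s _ hN
    have hnN : n + 1 ≤ N := by
      by_contra! hlt
      have h3 : b ^ N ≤ b ^ n := Nat.pow_le_pow_right (by omega) (by omega)
      have h4 : b ^ n ≤ κ * b ^ n := Nat.le_mul_of_pos_left _ h0
      omega
    rcases eq_or_ne m 0 with rfl | hm0
    · rw [muPer_lead_zero hb h0 h1, muPer_lead_zero hb h0 h1]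
      linarith [add_mul s 1 (n + 1)]
    · rcases s with _ | s
      · rw [muPer_lead hb h0 h1 h2 hm0, muPer_zero_left, muPer_zero_left]
        omega
      · rw [muPer_lead hb h0 h1 h2 hm0, muPer_lead hb h0 h1 h2 hm0]
        have := ih n s hm0 h2
        omega

/-- If `k` has at least two nonzero digits, then the increments of `s ↦ muPer b s k` after the
first one are smaller than the first one. -/
theorem muPer_succ_le_of_lead {b κ n m : ℕ} (hb : 2 ≤ b) (hκ0 : 0 < κ) (hκ : κ < b)
    (hm : m < b ^ n) (hm0 : m ≠ 0) (s : ℕ) :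
    muPer b (s + 2) (κ * b ^ n + m) ≤ muPer b (s + 1) (κ * b ^ n + m) + n := by
  rw [muPer_lead hb hκ0 hκ hm hm0, muPer_lead hb hκ0 hκ hm hm0]
  have := muPer_succ_le hb m n s hm0 hm
  omega

/-! ### The conjugate Walsh functions and their primitives -/

/-- The conjugate of `ω_b = exp (2 π i / b)`. -/
noncomputable def walshRoot (b : ℕ) : ℂ :=
  (starRingEnd ℂ) (Complex.exp (2 * Real.pi * Complex.I / b))

/-- The complex conjugate of the `k`-th Walsh function in base `b`. -/
noncomputable def conjWalsh (b k : ℕ) (x : ℝ) : ℂ := (starRingEnd ℂ) (walsh b k x)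

/-- The bound `1 / (2 sin (π / b))` of `1 / |1 - ω|` over the `b`-th roots of unity `ω ≠ 1`. -/
noncomputable def rootGap (b : ℕ) : ℝ := 1 / (2 * Real.sin (Real.pi / b))

theorem isPrimitiveRoot_walshRoot {b : ℕ} (hb : 2 ≤ b) : IsPrimitiveRoot (walshRoot b) b :=
  (Complex.isPrimitiveRoot_exp b (by omega)).map_of_injective (f := starRingEnd ℂ)
    (starRingEnd ℂ).injective

theorem norm_walshRoot {b : ℕ} (hb : 2 ≤ b) : ‖walshRoot b‖ = 1 :=
  (isPrimitiveRoot_walshRoot hb).norm'_eq_one (by omega)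

theorem walshRoot_pow_mod {b : ℕ} (hb : 2 ≤ b) (j : ℕ) :
    walshRoot b ^ (j % b) = walshRoot b ^ j := by
  conv_rhs => rw [← Nat.div_add_mod j b, pow_add, pow_mul,
    (isPrimitiveRoot_walshRoot hb).pow_eq_one, one_pow, one_mul]

theorem sin_pi_div_pos {b : ℕ} (hb : 2 ≤ b) : 0 < Real.sin (Real.pi / b) := by
  have hb' : (2 : ℝ) ≤ b := by exact_mod_cast hb
  apply Real.sin_pos_of_pos_of_lt_pi (by positivity)
  rw [div_lt_iff₀ (by linarith)]
  nlinarith [Real.pi_pos]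

theorem rootGap_pos {b : ℕ} (hb : 2 ≤ b) : 0 < rootGap b := by
  have := sin_pi_div_pos hb
  rw [rootGap]
  positivity

theorem one_le_two_mul_rootGap {b : ℕ} (hb : 2 ≤ b) : 1 ≤ 2 * rootGap b := by
  have h := sin_pi_div_pos hb
  rw [rootGap, show 2 * (1 / (2 * Real.sin (Real.pi / b))) = 1 / Real.sin (Real.pi / b) by
    field_simp, le_div_iff₀ h, one_mul]
  exact Real.sin_le_one _

theorem sin_pi_div_le {b θ : ℕ} (hb : 2 ≤ b) (h0 : 0 < θ) (h1 : θ < b) :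
    Real.sin (Real.pi / b) ≤ Real.sin (θ * Real.pi / b) := by
  have hb' : (2 : ℝ) ≤ b := by exact_mod_cast hb
  have hθ0 : (1 : ℝ) ≤ θ := by exact_mod_cast h0
  have hθ1 : (θ : ℝ) + 1 ≤ b := by exact_mod_cast h1
  have hpi := Real.pi_pos
  have hlow : -(Real.pi / 2) ≤ Real.pi / b := by
    have : 0 ≤ Real.pi / b := by positivity
    linarith
  rcases le_total (θ * Real.pi / b) (Real.pi / 2) with h | h
  · refine Real.sin_le_sin_of_le_of_le_pi_div_two hlow h ?_
    gcongr
    nlinarith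
  · rw [← Real.sin_pi_sub (θ * Real.pi / b)]
    refine Real.sin_le_sin_of_le_of_le_pi_div_two hlow (by linarith) ?_
    rw [le_sub_iff_add_le, ← add_div, div_le_iff₀ (by linarith)]
    nlinarith

theorem norm_one_sub_walshRoot_pow {b θ : ℕ} (hb : 2 ≤ b) (h0 : 0 < θ) (h1 : θ < b) :
    2 * Real.sin (Real.pi / b) ≤ ‖1 - walshRoot b ^ θ‖ := by
  have hb' : (2 : ℝ) ≤ b := by exact_mod_cast hb
  have key : ‖1 - walshRoot b ^ θ‖ = 2 * |Real.sin (θ * Real.pi / b)| := by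
    have h2 := Complex.norm_exp_I_mul_ofReal_sub_one (2 * (θ * Real.pi / b))
    have h3 : 1 - walshRoot b ^ θ = -(starRingEnd ℂ)
        (Complex.exp (Complex.I * ((2 * (θ * Real.pi / b) : ℝ) : ℂ)) - 1) := by
      have h4 : Complex.I * ((2 * (θ * Real.pi / b) : ℝ) : ℂ) =
          (θ : ℂ) * (2 * Real.pi * Complex.I / b) := by
        push_cast
        ring
      rw [map_sub, map_one, walshRoot, ← map_pow, ← Complex.exp_nat_mul, neg_sub, h4]
    rw [h3, norm_neg, RCLike.norm_conj, h2, norm_mul]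
    simp
  rw [key]
  have := (sin_pi_div_le hb h0 h1).trans (le_abs_self _)
  linarith

theorem one_sub_walshRoot_pow_ne_zero {b θ : ℕ} (hb : 2 ≤ b) (h0 : 0 < θ) (h1 : θ < b) :
    1 - walshRoot b ^ θ ≠ 0 := by
  intro h
  have h2 := norm_one_sub_walshRoot_pow hb h0 h1
  rw [h, norm_zero] at h2
  linarith [sin_pi_div_pos hb]

theorem norm_inv_one_sub_walshRoot_pow {b θ : ℕ} (hb : 2 ≤ b) (h0 : 0 < θ) (h1 : θ < b) :
    ‖(1 - walshRoot b ^ θ)⁻¹‖ ≤ rootGap b := by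
  have := sin_pi_div_pos hb
  rw [norm_inv, rootGap, one_div]
  exact inv_anti₀ (by positivity) (norm_one_sub_walshRoot_pow hb h0 h1)

theorem norm_half_sub_inv_one_sub_walshRoot_pow {b θ : ℕ} (hb : 2 ≤ b) (h0 : 0 < θ)
    (h1 : θ < b) : ‖1 / 2 - (1 - walshRoot b ^ θ)⁻¹‖ ≤ rootGap b := by
  have hne := one_sub_walshRoot_pow_ne_zero hb h0 h1
  have h2 : 1 / 2 - (1 - walshRoot b ^ θ)⁻¹ =
      (-(1 + walshRoot b ^ θ) / 2) * (1 - walshRoot b ^ θ)⁻¹ := by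
    field_simp
    ring
  have h3 : ‖-(1 + walshRoot b ^ θ) / 2‖ ≤ 1 := by
    rw [norm_div, norm_neg, Complex.norm_ofNat, div_le_one (by norm_num)]
    refine (norm_add_le _ _).trans ?_
    rw [norm_one, norm_pow, norm_walshRoot hb, one_pow]
    norm_num
  rw [h2, norm_mul]
  calc _ ≤ 1 * rootGap b := by
        gcongr
        exact norm_inv_one_sub_walshRoot_pow hb h0 h1
    _ = _ := one_mul _

/-- The coefficient of the character `d ↦ ω_b ^ (-θ d)` in the discrete Fourier expansion of the
centred digit `d - (b - 1) / 2`. -/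
noncomputable def digitCoeff (b θ : ℕ) : ℂ := walshRoot b ^ θ * (1 - walshRoot b ^ θ)⁻¹

theorem norm_digitCoeff_le {b θ : ℕ} (hb : 2 ≤ b) (h0 : 0 < θ) (h1 : θ < b) :
    ‖digitCoeff b θ‖ ≤ rootGap b := by
  rw [digitCoeff, norm_mul, norm_pow, norm_walshRoot hb, one_pow, one_mul]
  exact norm_inv_one_sub_walshRoot_pow hb h0 h1

theorem sum_walshRoot_pow {b e : ℕ} (hb : 2 ≤ b) (he : ¬ b ∣ e) :
    ∑ θ ∈ Finset.range b, walshRoot b ^ (θ * e) = 0 := by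
  have h1 : walshRoot b ^ e ≠ 1 := fun h =>
    he ((isPrimitiveRoot_walshRoot hb).dvd_of_pow_eq_one e h)
  have h2 : (walshRoot b ^ e - 1) * ∑ θ ∈ Finset.range b, (walshRoot b ^ e) ^ θ = 0 := by
    rw [mul_geom_sum, ← pow_mul, mul_comm, pow_mul, (isPrimitiveRoot_walshRoot hb).pow_eq_one,
      one_pow, sub_self]
  rw [mul_eq_zero, sub_eq_zero] at h2
  simpa only [← pow_mul, mul_comm e] using h2.resolve_left h1

/-- The discrete Fourier expansion of a centred base `b` digit. -/
theorem digit_sub_eq_sum {b d : ℕ} (hb : 2 ≤ b) (hd : d < b) :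
    (d : ℂ) - ((b : ℂ) - 1) / 2 =
      ∑ θ ∈ Finset.Ico 1 b, digitCoeff b θ * walshRoot b ^ (θ * d) := by
  set T : ℕ → ℂ := fun d => ∑ θ ∈ Finset.Ico 1 b, digitCoeff b θ * walshRoot b ^ (θ * d) with hT
  -- Consecutive values differ by one, as the sum of all `b`-th roots of unity vanishes.
  have hstep : ∀ d, d + 1 < b → T (d + 1) = T d + 1 := by
    intro d hd
    have h1 := sum_walshRoot_pow hb (e := d + 1)
      (fun h => by have := Nat.le_of_dvd (by omega) h; omega)
    rw [Finset.range_eq_Ico, Finset.sum_eq_sum_Ico_succ_bot (by omega)] at h1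
    have h2 : T (d + 1) - T d = -∑ θ ∈ Finset.Ico 1 b, walshRoot b ^ (θ * (d + 1)) := by
      simp only [hT]
      rw [← Finset.sum_sub_distrib, ← Finset.sum_neg_distrib]
      refine Finset.sum_congr rfl fun θ hθ => ?_
      rw [Finset.mem_Ico] at hθ
      have hne := one_sub_walshRoot_pow_ne_zero hb (by omega : 0 < θ) hθ.2
      rw [digitCoeff, mul_add, mul_one, pow_add]
      field_simp
      ring
    simp only [zero_mul, pow_zero, zero_add] at h1
    linear_combination h2 - h1
  have hlin : ∀ d, d < b → T d = T 0 + d := by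
    intro d
    induction d with
    | zero => simp
    | succ d ih =>
      intro hd
      rw [hstep d hd, ih (by omega)]
      push_cast
      ring
  -- The values at `0, …, b - 1` sum to zero, which fixes the value at `0`.
  have hsum : ∑ d ∈ Finset.range b, T d = 0 := by
    simp only [hT]
    rw [Finset.sum_comm]
    refine Finset.sum_eq_zero fun θ hθ => ?_
    rw [Finset.mem_Ico] at hθ
    have h1 := sum_walshRoot_pow hb (e := θ)
      (fun h => by have := Nat.le_of_dvd (by omega) h; omega)
    rw [← Finset.mul_sum]
    simp only [mul_comm θ, h1, mul_zero]
  have hgauss : ∑ d ∈ Finset.range b, (d : ℂ) = b * (b - 1) / 2 := by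
    have h := Finset.sum_range_id_mul_two b
    have h' : (∑ d ∈ Finset.range b, (d : ℂ)) * 2 = b * (b - 1) := by
      have := congrArg (Nat.cast : ℕ → ℂ) h
      rw [Nat.cast_mul, Nat.cast_mul, Nat.cast_sum, Nat.cast_sub (by omega)] at this
      simpa using this
    linear_combination h' / 2
  rw [Finset.sum_congr rfl fun d hd => hlin d (Finset.mem_range.1 hd), Finset.sum_add_distrib,
    hgauss, Finset.sum_const, Finset.card_range, nsmul_eq_mul] at hsum
  have hb0 : (b : ℂ) ≠ 0 := by
    have : b ≠ 0 := by omega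
    exact_mod_cast this
  have hT0 : T 0 = -(((b : ℂ) - 1) / 2) := by
    apply mul_left_cancel₀ hb0
    linear_combination hsum
  change _ = T d
  rw [hlin d hd, hT0]
  ring

theorem conjWalsh_eq (b k : ℕ) (x : ℝ) :
    conjWalsh b k x =
      walshRoot b ^ (∑ a ∈ digitPositions b k, natDigit b k a * realDigit b x a) := by
  rw [conjWalsh, walsh, map_pow, walshRoot]

theorem norm_conjWalsh {b : ℕ} (hb : 2 ≤ b) (k : ℕ) (x : ℝ) : ‖conjWalsh b k x‖ = 1 := by
  rw [conjWalsh_eq, norm_pow, norm_walshRoot hb, one_pow]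

theorem conjWalsh_zero (b : ℕ) (x : ℝ) : conjWalsh b 0 x = 1 := by
  simp [conjWalsh_eq, digitPositions_zero]

theorem conjWalsh_lead {b κ n m : ℕ} (hb : 2 ≤ b) (hκ0 : 0 < κ) (hκ : κ < b) (hm : m < b ^ n)
    (x : ℝ) :
    conjWalsh b (κ * b ^ n + m) x =
      walshRoot b ^ (κ * realDigit b x (n + 1)) * conjWalsh b m x := by
  rw [conjWalsh_eq, conjWalsh_eq, digitPositions_lead hb hκ0 hκ hm,
    Finset.sum_insert (succ_notMem_digitPositions hb hm), natDigit_lead hκ hm, pow_add]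
  congr 2
  refine Finset.sum_congr rfl fun a ha => ?_
  rw [natDigit_tail κ m (by omega) ((mem_digitPositions hb).1 ha).1
    (le_of_mem_digitPositions hb hm ha)]

theorem floor_mul_pow_div {b : ℕ} (hb : 2 ≤ b) (x : ℝ) (i d : ℕ) :
    ⌊x * (b : ℝ) ^ (i + d)⌋₊ / b ^ d = ⌊x * (b : ℝ) ^ i⌋₊ := by
  have hb' : (b : ℝ) ^ d ≠ 0 := pow_ne_zero _ (by norm_cast; omega)
  rw [← Nat.floor_div_natCast]
  congr 1
  push_cast
  rw [pow_add]
  field_simp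

/-- If `k < b ^ n`, then the `k`-th Walsh function is constant on the `b`-adic intervals of
length `b ^ (-n)`. -/
theorem exists_conjWalsh_eq_floor {b n k : ℕ} (hb : 2 ≤ b) (hk : k < b ^ n) :
    ∃ u : ℕ → ℂ, ∀ x, conjWalsh b k x = u ⌊x * (b : ℝ) ^ n⌋₊ := by
  refine ⟨fun j => walshRoot b ^
    (∑ a ∈ digitPositions b k, natDigit b k a * (j / b ^ (n - a) % b)), fun x => ?_⟩
  rw [conjWalsh_eq]
  congr 1
  refine Finset.sum_congr rfl fun a ha => ?_
  have han := le_of_mem_digitPositions hb hk ha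
  rw [realDigit, ← floor_mul_pow_div hb x a (n - a), Nat.add_sub_cancel' han]

theorem measurable_conjWalsh {b : ℕ} (hb : 2 ≤ b) (k : ℕ) : Measurable (conjWalsh b k) := by
  obtain ⟨u, hu⟩ := exists_conjWalsh_eq_floor hb (Nat.lt_pow_self (by omega : 1 < b) (n := k))
  rw [funext hu]
  exact (measurable_from_nat (f := u)).comp (Nat.measurable_floor.comp (by fun_prop))

theorem intervalIntegrable_conjWalsh {b : ℕ} (hb : 2 ≤ b) (k : ℕ) (x y : ℝ) :
    IntervalIntegrable (conjWalsh b k) volume x y := by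
  refine IntervalIntegrable.mono_fun' (g := fun _ => (1 : ℝ)) intervalIntegrable_const
    (measurable_conjWalsh hb k).aestronglyMeasurable ?_
  exact Filter.Eventually.of_forall fun t => (norm_conjWalsh hb k t).le

theorem integral_step (g : ℕ → ℂ) {y : ℝ} (hy : 0 ≤ y) :
    ∫ t in (0 : ℝ)..y, g ⌊t⌋₊ =
      ∑ j ∈ Finset.range ⌊y⌋₊, g j + ((y - ⌊y⌋₊ : ℝ) : ℂ) * g ⌊y⌋₊ := by
  -- On `[j, z]` with `z ≤ j + 1` the integrand is constant up to the end point.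
  have hpiece : ∀ (j : ℕ) (z : ℝ), (j : ℝ) ≤ z → z ≤ j + 1 →
      (∫ t in (j : ℝ)..z, g ⌊t⌋₊ = ((z - j : ℝ) : ℂ) * g j) ∧
      IntervalIntegrable (fun t => g ⌊t⌋₊) volume j z := by
    intro j z h1 h2
    have hae : ∀ᵐ t : ℝ, t ∈ uIoc (j : ℝ) z → g ⌊t⌋₊ = g j := by
      filter_upwards [compl_mem_ae_iff.2 (measure_singleton z)] with t ht htm
      rw [uIoc_of_le h1] at htm
      have hne : t ≠ z := ht
      have : ⌊t⌋₊ = j := by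
        rw [Nat.floor_eq_iff (by linarith [htm.1, (Nat.cast_nonneg j : (0 : ℝ) ≤ j)])]
        exact ⟨htm.1.le, (lt_of_le_of_ne htm.2 hne).trans_le h2⟩
      rw [this]
    constructor
    · rw [intervalIntegral.integral_congr_ae hae, intervalIntegral.integral_const,
        Complex.real_smul]
    · refine (intervalIntegrable_const (c := g j)).congr_ae ?_
      rw [Filter.EventuallyEq, ae_restrict_iff' measurableSet_uIoc]
      filter_upwards [hae] with t ht h using (ht h).symm
  have hint : ∀ j : ℕ, IntervalIntegrable (fun t => g ⌊t⌋₊) volume (j : ℝ) ((j + 1 : ℕ) : ℝ) := by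
    intro j
    exact (hpiece j _ (by push_cast; linarith) (by push_cast; linarith)).2
  have hlast := hpiece ⌊y⌋₊ y (Nat.floor_le hy) (Nat.lt_floor_add_one y).le
  have hsum := intervalIntegral.sum_integral_adjacent_intervals
    (f := fun t : ℝ => g ⌊t⌋₊) (a := fun j : ℕ => (j : ℝ)) (n := ⌊y⌋₊) (fun j _ => hint j)
  have htot := IntervalIntegrable.trans_iterate (f := fun t : ℝ => g ⌊t⌋₊) (μ := volume)
    (a := fun j : ℕ => (j : ℝ)) (n := ⌊y⌋₊) (fun j _ => hint j)
  simp only [Nat.cast_zero] at hsum htot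
  rw [← intervalIntegral.integral_add_adjacent_intervals htot hlast.2, ← hsum, hlast.1]
  congr 1
  refine Finset.sum_congr rfl fun j _ => ?_
  rw [(hpiece j _ (by push_cast; linarith) (by push_cast; linarith)).1]
  simp

/-- Summing a function `u` of the leading digits against the character of the last digit: the
sums over full blocks of `b` terms vanish. -/
theorem sum_walshRoot_pow_mul {b κ : ℕ} (hb : 2 ≤ b) (hκ0 : 0 < κ) (hκ : κ < b) (u : ℕ → ℂ)
    (q : ℕ) :
    ∑ j ∈ Finset.range q, walshRoot b ^ (κ * j) * u (j / b) =
      (1 - walshRoot b ^ κ)⁻¹ * (u (q / b) - walshRoot b ^ (κ * q) * u (q / b)) := by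
  have hne := one_sub_walshRoot_pow_ne_zero hb hκ0 hκ
  induction q with
  | zero => simp
  | succ q ih =>
    rw [Finset.sum_range_succ, ih]
    rcases Nat.eq_or_lt_of_le (Nat.succ_le_of_lt (Nat.mod_lt q (by omega : 0 < b))) with h | h
    -- Either `q` completes a block of `b` terms, or `q` and `q + 1` lie in the same block.
    · have hdvd : b ∣ q + 1 := ⟨q / b + 1, by
        have := Nat.div_add_mod q b
        rw [mul_add, mul_one]
        omega⟩
      have hone : walshRoot b ^ (κ * (q + 1)) = 1 := by
        rw [(isPrimitiveRoot_walshRoot hb).pow_eq_one_iff_dvd]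
        exact Dvd.dvd.mul_left hdvd κ
      have hone' : walshRoot b ^ (κ * q) * walshRoot b ^ κ = 1 := by
        rw [← pow_add, ← hone]
        ring_nf
      rw [hone]
      field_simp
      linear_combination (-u (q / b)) * hone'
    · have hdiv : (q + 1) / b = q / b := by
        rw [Nat.succ_div, if_neg, add_zero]
        intro hdvd
        have h1 := Nat.div_add_mod q b
        obtain ⟨c, hc⟩ := hdvd
        have h2 : (q + 1) % b = 0 := by rw [hc]; exact Nat.mul_mod_right b c
        have h3 : (q + 1) % b = q % b + 1 := by
          rw [Nat.add_mod, Nat.mod_eq_of_lt (by omega : 1 < b), Nat.mod_eq_of_lt h]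
        omega
      rw [hdiv, mul_add, mul_one, pow_add]
      field_simp
      ring

/-- The sawtooth function `{t} - 1 / 2` on `[0, ∞)`. -/
noncomputable def sawtooth (t : ℝ) : ℝ := t - ⌊t⌋₊ - 1 / 2

theorem abs_sawtooth_le {t : ℝ} (ht : 0 ≤ t) : |sawtooth t| ≤ 1 / 2 := by
  have h1 := Nat.floor_le ht
  have h2 := Nat.lt_floor_add_one t
  rw [sawtooth, abs_le]
  constructor <;> linarith

/-- The primitive of a Walsh function of index `κ b ^ n + m` in closed form. -/
theorem integral_conjWalsh {b κ n m : ℕ} (hb : 2 ≤ b) (hκ0 : 0 < κ) (hκ : κ < b)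
    (hm : m < b ^ n) {x : ℝ} (hx : 0 ≤ x) :
    ∫ t in (0 : ℝ)..x, conjWalsh b (κ * b ^ n + m) t =
      ((b : ℂ) ^ (n + 1))⁻¹ * ((1 - walshRoot b ^ κ)⁻¹ * conjWalsh b m x +
        (((sawtooth (x * (b : ℝ) ^ (n + 1)) : ℝ) : ℂ) + 1 / 2 - (1 - walshRoot b ^ κ)⁻¹) *
          conjWalsh b (κ * b ^ n + m) x) := by
  obtain ⟨u, hu⟩ := exists_conjWalsh_eq_floor hb hm
  have hb0 : (b : ℝ) ≠ 0 := by norm_cast; omega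
  have hm' : ∀ t : ℝ, conjWalsh b m t = u (⌊t * (b : ℝ) ^ (n + 1)⌋₊ / b) := fun t => by
    have := floor_mul_pow_div hb t n 1
    rw [pow_one] at this
    rw [hu, this]
  have hk : ∀ t : ℝ, conjWalsh b (κ * b ^ n + m) t =
      walshRoot b ^ (κ * ⌊t * (b : ℝ) ^ (n + 1)⌋₊) * u (⌊t * (b : ℝ) ^ (n + 1)⌋₊ / b) := by
    intro t
    rw [conjWalsh_lead hb hκ0 hκ hm, hm', realDigit, mul_comm κ, pow_mul, walshRoot_pow_mod hb,
      ← pow_mul, mul_comm κ]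
  simp only [hk, hm']
  rw [intervalIntegral.integral_comp_mul_right
    (fun t => walshRoot b ^ (κ * ⌊t⌋₊) * u (⌊t⌋₊ / b)) (pow_ne_zero (n + 1) hb0), zero_mul,
    integral_step (fun j => walshRoot b ^ (κ * j) * u (j / b)) (by positivity),
    sum_walshRoot_pow_mul hb hκ0 hκ, sawtooth, Complex.real_smul]
  push_cast
  ring

theorem integral_conjWalsh_eq_zero {b k : ℕ} (hb : 2 ≤ b) (hk : k ≠ 0) :
    ∫ t in (0 : ℝ)..1, conjWalsh b k t = 0 := by
  -- All digits of `1` after the point are zero.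
  have hone : ∀ j, conjWalsh b j 1 = 1 := by
    intro j
    rw [conjWalsh_eq, Finset.sum_eq_zero, pow_zero]
    intro a ha
    obtain ⟨c, rfl⟩ : ∃ c, a = c + 1 := ⟨a - 1, by have := ((mem_digitPositions hb).1 ha).1; omega⟩
    rw [realDigit, one_mul, ← Nat.cast_pow, Nat.floor_natCast, pow_succ, Nat.mul_mod_left, mul_zero]
  obtain ⟨κ, n, m, h0, h1, h2, rfl⟩ := exists_lead hb hk
  have hsaw : sawtooth (1 * (b : ℝ) ^ (n + 1)) = -(1 / 2) := by
    rw [sawtooth, one_mul, ← Nat.cast_pow, Nat.floor_natCast, sub_self, zero_sub]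
  rw [integral_conjWalsh hb h0 h1 h2 zero_le_one, hone, hone, hsaw]
  push_cast
  ring

theorem sawtooth_eq {b : ℕ} (hb : 2 ≤ b) (x : ℝ) (a : ℕ) :
    sawtooth (x * (b : ℝ) ^ a) =
      (b : ℝ)⁻¹ * ((realDigit b x (a + 1) : ℝ) - ((b : ℝ) - 1) / 2) +
        (b : ℝ)⁻¹ * sawtooth (x * (b : ℝ) ^ (a + 1)) := by
  have hb0 : (b : ℝ) ≠ 0 := by norm_cast; omega
  have h1 := floor_mul_pow_div hb x a 1
  rw [pow_one] at h1
  have h2 := Nat.div_add_mod ⌊x * (b : ℝ) ^ (a + 1)⌋₊ b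
  rw [h1] at h2
  have h3 : (b : ℝ) * ⌊x * (b : ℝ) ^ a⌋₊ + realDigit b x (a + 1) =
      ⌊x * (b : ℝ) ^ (a + 1)⌋₊ := by
    rw [realDigit]
    exact_mod_cast h2
  rw [sawtooth, sawtooth, ← h3, pow_succ]
  field_simp
  ring

/-- The base `b` expansion of the sawtooth function, truncated after `N` digits. -/
theorem sawtooth_expansion {b : ℕ} (hb : 2 ≤ b) (x : ℝ) (a N : ℕ) :
    sawtooth (x * (b : ℝ) ^ a) =
      ∑ c ∈ Finset.range N,
        ((b : ℝ) ^ (c + 1))⁻¹ * ((realDigit b x (a + c + 1) : ℝ) - ((b : ℝ) - 1) / 2) +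
      ((b : ℝ) ^ N)⁻¹ * sawtooth (x * (b : ℝ) ^ (a + N)) := by
  induction N with
  | zero => simp
  | succ N ih =>
    rw [ih, sawtooth_eq hb x (a + N), Finset.sum_range_succ, pow_succ (b : ℝ) N, mul_inv,
      ← add_assoc a N 1]
    ring

/-- The Walsh expansion of the primitive of a Walsh function, with remainder. -/
theorem integral_conjWalsh_expansion {b κ n m : ℕ} (hb : 2 ≤ b) (hκ0 : 0 < κ) (hκ : κ < b)
    (hm : m < b ^ n) (N : ℕ) {x : ℝ} (hx : 0 ≤ x) :
    ∫ t in (0 : ℝ)..x, conjWalsh b (κ * b ^ n + m) t =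
      ((b : ℂ) ^ (n + 1))⁻¹ * ((1 - walshRoot b ^ κ)⁻¹ * conjWalsh b m x +
        (1 / 2 - (1 - walshRoot b ^ κ)⁻¹) * conjWalsh b (κ * b ^ n + m) x +
        ∑ c ∈ Finset.range N, ∑ θ ∈ Finset.Ico 1 b, ((b : ℂ) ^ (c + 1))⁻¹ * digitCoeff b θ *
          conjWalsh b (θ * b ^ (n + 1 + c) + (κ * b ^ n + m)) x) +
      ((b : ℂ) ^ (n + 1))⁻¹ * ((b : ℂ) ^ N)⁻¹ *
        ((sawtooth (x * (b : ℝ) ^ (n + 1 + N)) : ℝ) : ℂ) * conjWalsh b (κ * b ^ n + m) x := by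
  have hk : ∀ c, κ * b ^ n + m < b ^ (n + 1 + c) := fun c =>
    (lead_lt_pow hκ hm).trans_le (Nat.pow_le_pow_right (by omega) (by omega))
  have hdig : ∀ c, ∑ θ ∈ Finset.Ico 1 b, ((b : ℂ) ^ (c + 1))⁻¹ * digitCoeff b θ *
      conjWalsh b (θ * b ^ (n + 1 + c) + (κ * b ^ n + m)) x =
      ((b : ℂ) ^ (c + 1))⁻¹ * ((realDigit b x (n + 1 + c + 1) : ℂ) - ((b : ℂ) - 1) / 2) *
        conjWalsh b (κ * b ^ n + m) x := by
    intro c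
    rw [digit_sub_eq_sum hb (d := realDigit b x (n + 1 + c + 1)) (Nat.mod_lt _ (by omega)),
      Finset.mul_sum, Finset.sum_mul]
    refine Finset.sum_congr rfl fun θ hθ => ?_
    rw [Finset.mem_Ico] at hθ
    rw [conjWalsh_lead hb (by omega) hθ.2 (hk c)]
    ring
  rw [integral_conjWalsh hb hκ0 hκ hm hx, sawtooth_expansion hb x (n + 1) N,
    Finset.sum_congr rfl fun c _ => hdig c, ← Finset.sum_mul]
  push_cast
  ring

/-! ### The integration operator -/

/-- The space of functions `ℝ → ℂ` that are integrable on every bounded interval. -/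
def locInt : Submodule ℂ (ℝ → ℂ) where
  carrier := {h | ∀ x y : ℝ, IntervalIntegrable h volume x y}
  add_mem' hf hg x y := (hf x y).add (hg x y)
  zero_mem' _ _ := intervalIntegrable_const
  smul_mem' c _ hf x y := (hf x y).smul c

/-- The mean over `[0, 1]`. -/
noncomputable def meanUnit : locInt →ₗ[ℂ] ℂ where
  toFun h := ∫ t in (0 : ℝ)..1, (h : ℝ → ℂ) t
  map_add' f g := intervalIntegral.integral_add (f.2 0 1) (g.2 0 1)
  map_smul' c _ := intervalIntegral.integral_smul c _

theorem continuous_primitive_locInt (h : locInt) :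
    Continuous fun x : ℝ => ∫ t in (0 : ℝ)..x, (h : ℝ → ℂ) t :=
  intervalIntegral.continuous_primitive h.2 0

/-- The operator sending `h` to the primitive of `h - ∫₀¹ h` that vanishes at `0` (and hence
at `1`). -/
noncomputable def centredPrimitive : locInt →ₗ[ℂ] locInt where
  toFun h := ⟨fun x => (∫ t in (0 : ℝ)..x, (h : ℝ → ℂ) t) - x * meanUnit h, fun x y =>
    Continuous.intervalIntegrable ((continuous_primitive_locInt h).sub
      (Complex.continuous_ofReal.mul continuous_const)) x y⟩
  map_add' f g := by
    ext x
    have h1 : ∫ t in (0 : ℝ)..x, (f : ℝ → ℂ) t + (g : ℝ → ℂ) t =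
        (∫ t in (0 : ℝ)..x, (f : ℝ → ℂ) t) + ∫ t in (0 : ℝ)..x, (g : ℝ → ℂ) t :=
      intervalIntegral.integral_add (f.2 0 x) (g.2 0 x)
    simp only [map_add, Submodule.coe_add, Pi.add_apply, h1]
    ring
  map_smul' c f := by
    ext x
    have h1 : ∫ t in (0 : ℝ)..x, c * (f : ℝ → ℂ) t = c * ∫ t in (0 : ℝ)..x, (f : ℝ → ℂ) t :=
      intervalIntegral.integral_const_mul c _
    simp only [map_smul, Submodule.coe_smul, Pi.smul_apply, smul_eq_mul, h1, RingHom.id_apply]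
    ring

/-- Evaluation at a point. -/
def evalAt (y : ℝ) : locInt →ₗ[ℂ] ℂ where
  toFun h := (h : ℝ → ℂ) y
  map_add' _ _ := rfl
  map_smul' _ _ := rfl

theorem meanUnit_apply (h : locInt) : meanUnit h = ∫ t in (0 : ℝ)..1, (h : ℝ → ℂ) t := rfl

theorem evalAt_apply (y : ℝ) (h : locInt) : evalAt y h = (h : ℝ → ℂ) y := rfl

theorem centredPrimitive_apply (h : locInt) (x : ℝ) :
    (centredPrimitive h : ℝ → ℂ) x = (∫ t in (0 : ℝ)..x, (h : ℝ → ℂ) t) - x * meanUnit h := rfl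

theorem centredPrimitive_one (h : locInt) : (centredPrimitive h : ℝ → ℂ) 1 = 0 := by
  simp [centredPrimitive_apply, meanUnit_apply]

/-- Boundedness of a linear functional with respect to the supremum over `[0, 1]`. -/
def SupBounded (L : locInt →ₗ[ℂ] ℂ) : Prop :=
  ∃ K : ℝ, ∀ (h : locInt) (M : ℝ), (∀ x ∈ Icc (0 : ℝ) 1, ‖(h : ℝ → ℂ) x‖ ≤ M) → ‖L h‖ ≤ K * M

theorem norm_integral_le_of_unit {h : ℝ → ℂ} {M x : ℝ} (hM : ∀ x ∈ Icc (0 : ℝ) 1, ‖h x‖ ≤ M)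
    (hx : x ∈ Icc (0 : ℝ) 1) : ‖∫ t in (0 : ℝ)..x, h t‖ ≤ M := by
  have h0 : 0 ≤ M := (norm_nonneg _).trans (hM 0 ⟨le_rfl, zero_le_one⟩)
  have h1 := intervalIntegral.norm_integral_le_of_norm_le_const (a := (0 : ℝ)) (b := x) (f := h)
    (C := M) (fun t ht => by
      rw [uIoc_of_le hx.1] at ht
      exact hM t ⟨ht.1.le, ht.2.trans hx.2⟩)
  rw [sub_zero, abs_of_nonneg hx.1] at h1
  exact h1.trans (mul_le_of_le_one_right h0 hx.2)

theorem supBounded_meanUnit : SupBounded meanUnit :=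
  ⟨1, fun _ _ hM => by
    rw [one_mul]
    exact norm_integral_le_of_unit hM ⟨zero_le_one, le_rfl⟩⟩

theorem supBounded_evalAt {y : ℝ} (hy : y ∈ Icc (0 : ℝ) 1) : SupBounded (evalAt y) :=
  ⟨1, fun _ _ hM => by
    rw [one_mul]
    exact hM y hy⟩

theorem SupBounded.sub {L₁ L₂ : locInt →ₗ[ℂ] ℂ} (h₁ : SupBounded L₁) (h₂ : SupBounded L₂) :
    SupBounded (L₁ - L₂) := by
  obtain ⟨K₁, h₁⟩ := h₁
  obtain ⟨K₂, h₂⟩ := h₂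
  refine ⟨K₁ + K₂, fun h M hM => ?_⟩
  rw [LinearMap.sub_apply, add_mul]
  exact (norm_sub_le _ _).trans (add_le_add (h₁ h M hM) (h₂ h M hM))

theorem SupBounded.comp_centredPrimitive {L : locInt →ₗ[ℂ] ℂ} (hL : SupBounded L) :
    SupBounded (L ∘ₗ centredPrimitive) := by
  obtain ⟨K, hK⟩ := hL
  refine ⟨K * 2, fun h M hM => ?_⟩
  rw [LinearMap.comp_apply, mul_assoc]
  refine hK _ _ fun x hx => ?_
  have h0 : 0 ≤ M := (norm_nonneg _).trans (hM 0 ⟨le_rfl, zero_le_one⟩)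
  have h1 := norm_integral_le_of_unit hM hx
  have h2 := norm_integral_le_of_unit hM (x := 1) ⟨zero_le_one, le_rfl⟩
  have h3 : ‖(x : ℂ) * meanUnit h‖ ≤ M := by
    rw [norm_mul, Complex.norm_real, Real.norm_of_nonneg hx.1]
    exact (mul_le_of_le_one_left (norm_nonneg _) hx.2).trans h2
  rw [centredPrimitive_apply]
  refine (norm_sub_le _ _).trans ?_
  linarith

theorem SupBounded.comp_pow {L : locInt →ₗ[ℂ] ℂ} (hL : SupBounded L) (s : ℕ) :
    SupBounded (L ∘ₗ centredPrimitive ^ s) := by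
  induction s with
  | zero => exact hL
  | succ s ih =>
    rw [pow_succ, Module.End.mul_eq_comp, ← LinearMap.comp_assoc]
    exact ih.comp_centredPrimitive

/-- The conjugate Walsh function as a locally integrable function. -/
noncomputable def walshFun {b : ℕ} (hb : 2 ≤ b) (k : ℕ) : locInt :=
  ⟨conjWalsh b k, intervalIntegrable_conjWalsh hb k⟩

theorem walshFun_apply {b : ℕ} (hb : 2 ≤ b) (k : ℕ) (x : ℝ) :
    (walshFun hb k : ℝ → ℂ) x = conjWalsh b k x := rfl

theorem meanUnit_walshFun {b k : ℕ} (hb : 2 ≤ b) (hk : k ≠ 0) :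
    meanUnit (walshFun hb k) = 0 := integral_conjWalsh_eq_zero hb hk

theorem meanUnit_walshFun_zero {b : ℕ} (hb : 2 ≤ b) : meanUnit (walshFun hb 0) = 1 := by
  simp [meanUnit_apply, walshFun_apply, conjWalsh_zero]

theorem centredPrimitive_walshFun_zero {b : ℕ} (hb : 2 ≤ b) :
    centredPrimitive (walshFun hb 0) = 0 := by
  ext x
  rw [centredPrimitive_apply, meanUnit_walshFun_zero]
  simp [walshFun_apply, conjWalsh_zero]

theorem centredPrimitive_walshFun {b k : ℕ} (hb : 2 ≤ b) (hk : k ≠ 0) (x : ℝ) :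
    (centredPrimitive (walshFun hb k) : ℝ → ℂ) x = ∫ t in (0 : ℝ)..x, conjWalsh b k t := by
  rw [centredPrimitive_apply, meanUnit_walshFun hb hk, mul_zero, sub_zero]
  rfl

theorem sum_inv_pow_sq_le {b : ℕ} (hb : 2 ≤ b) (N : ℕ) :
    ∑ c ∈ Finset.range N, ((b : ℝ) - 1) * (((b : ℝ) ^ (c + 1))⁻¹ * ((b : ℝ) ^ (c + 1))⁻¹) ≤
      1 / ((b : ℝ) + 1) := by
  have hb' : (2 : ℝ) ≤ b := by exact_mod_cast hb
  have h : ∀ N : ℕ, ∑ c ∈ Finset.range N,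
      ((b : ℝ) - 1) * (((b : ℝ) ^ (c + 1))⁻¹ * ((b : ℝ) ^ (c + 1))⁻¹) =
      (1 - ((b : ℝ) ^ N)⁻¹ * ((b : ℝ) ^ N)⁻¹) / ((b : ℝ) + 1) := by
    intro N
    induction N with
    | zero => simp
    | succ N ih =>
      rw [Finset.sum_range_succ, ih, pow_succ]
      field_simp
      ring
  rw [h]
  have : 0 ≤ ((b : ℝ) ^ N)⁻¹ * ((b : ℝ) ^ N)⁻¹ := by positivity
  gcongr
  linarith

/-- A functional bounded in the supremum norm can be applied to the Walsh expansion of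
`centredPrimitive (walshFun hb k)` term by term. -/
theorem norm_apply_centredPrimitive_walshFun_le {b κ n m : ℕ} (hb : 2 ≤ b) (hκ0 : 0 < κ)
    (hκ : κ < b) (hm : m < b ^ n) {L : locInt →ₗ[ℂ] ℂ} (hL : SupBounded L) {E : ℝ}
    (hE0 : 0 ≤ E)
    (hE : ∀ c θ : ℕ, 0 < θ → θ < b →
      ‖L (walshFun hb (θ * b ^ (n + 1 + c) + (κ * b ^ n + m)))‖ ≤ E * ((b : ℝ) ^ (c + 1))⁻¹) :
    ‖L (centredPrimitive (walshFun hb (κ * b ^ n + m)))‖ ≤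
      rootGap b * ((b : ℝ) ^ (n + 1))⁻¹ * (‖L (walshFun hb m)‖ +
        ‖L (walshFun hb (κ * b ^ n + m))‖ + E / ((b : ℝ) + 1)) := by
  obtain ⟨K, hK⟩ := hL
  have hb' : (2 : ℝ) ≤ b := by exact_mod_cast hb
  have hM := rootGap_pos hb
  set k := κ * b ^ n + m with hk
  -- The partial sums of the expansion; the remainder after `N` digits is at most `b ^ (-N)`.
  set P : ℕ → locInt := fun N => ((b : ℂ) ^ (n + 1))⁻¹ • ((1 - walshRoot b ^ κ)⁻¹ • walshFun hb m +
        (1 / 2 - (1 - walshRoot b ^ κ)⁻¹) • walshFun hb k +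
        ∑ c ∈ Finset.range N, ∑ θ ∈ Finset.Ico 1 b, (((b : ℂ) ^ (c + 1))⁻¹ * digitCoeff b θ) •
          walshFun hb (θ * b ^ (n + 1 + c) + k)) with hP
  have hrem : ∀ N, ‖L (centredPrimitive (walshFun hb k) - P N)‖ ≤ K * ((b : ℝ) ^ N)⁻¹ := by
    intro N
    refine hK _ _ fun x hx => ?_
    have h1 := integral_conjWalsh_expansion hb hκ0 hκ hm N hx.1
    have h2 : ((centredPrimitive (walshFun hb k) - P N : locInt) : ℝ → ℂ) x =
        ((b : ℂ) ^ (n + 1))⁻¹ * ((b : ℂ) ^ N)⁻¹ *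
          ((sawtooth (x * (b : ℝ) ^ (n + 1 + N)) : ℝ) : ℂ) * conjWalsh b k x := by
      rw [Submodule.coe_sub, Pi.sub_apply, centredPrimitive_walshFun hb (lead_ne_zero hκ0 hκ),
        h1, ← hk]
      simp only [hP, Submodule.coe_smul, Submodule.coe_add, Submodule.coe_sum, Pi.smul_apply,
        Pi.add_apply, Finset.sum_apply, walshFun_apply, smul_eq_mul]
      ring
    rw [h2, norm_mul, norm_mul, norm_mul, norm_conjWalsh hb, mul_one, Complex.norm_real,
      norm_inv, norm_inv, norm_pow, norm_pow, Complex.norm_natCast]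
    have h3 : ‖sawtooth (x * (b : ℝ) ^ (n + 1 + N))‖ ≤ 1 :=
      (abs_sawtooth_le (mul_nonneg hx.1 (by positivity))).trans (by norm_num)
    have h4 : ((b : ℝ) ^ (n + 1))⁻¹ ≤ 1 := inv_le_one_of_one_le₀ (one_le_pow₀ (by linarith))
    calc _ ≤ 1 * ((b : ℝ) ^ N)⁻¹ * 1 := by gcongr
      _ = _ := by ring
  have hmain : ∀ N, ‖L (P N)‖ ≤ rootGap b * ((b : ℝ) ^ (n + 1))⁻¹ * (‖L (walshFun hb m)‖ +
        ‖L (walshFun hb k)‖ + E / ((b : ℝ) + 1)) := by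
    intro N
    have hsum : ‖∑ c ∈ Finset.range N, ∑ θ ∈ Finset.Ico 1 b,
        ((b : ℂ) ^ (c + 1))⁻¹ * digitCoeff b θ * L (walshFun hb (θ * b ^ (n + 1 + c) + k))‖ ≤
        rootGap b * (E / ((b : ℝ) + 1)) := by
      calc _ ≤ ∑ c ∈ Finset.range N, ∑ θ ∈ Finset.Ico 1 b,
            ((b : ℝ) ^ (c + 1))⁻¹ * rootGap b * (E * ((b : ℝ) ^ (c + 1))⁻¹) := by
            refine (norm_sum_le _ _).trans (Finset.sum_le_sum fun c _ => ?_)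
            refine (norm_sum_le _ _).trans (Finset.sum_le_sum fun θ hθ => ?_)
            rw [Finset.mem_Ico] at hθ
            rw [norm_mul, norm_mul, norm_inv, norm_pow, Complex.norm_natCast]
            gcongr
            · exact norm_digitCoeff_le hb (by omega) hθ.2
            · exact hE c θ (by omega) hθ.2
        _ = rootGap b * E * ∑ c ∈ Finset.range N,
            ((b : ℝ) - 1) * (((b : ℝ) ^ (c + 1))⁻¹ * ((b : ℝ) ^ (c + 1))⁻¹) := by
            rw [Finset.mul_sum]
            refine Finset.sum_congr rfl fun c _ => ?_
            rw [Finset.sum_const, Nat.card_Ico, nsmul_eq_mul, Nat.cast_sub (by omega)]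
            push_cast
            ring
        _ ≤ rootGap b * E * (1 / ((b : ℝ) + 1)) := by
            gcongr
            exact sum_inv_pow_sq_le hb N
        _ = _ := by ring
    simp only [hP, map_smul, map_add, map_sum, smul_eq_mul]
    rw [norm_mul, norm_inv, norm_pow, Complex.norm_natCast, mul_comm (rootGap b), mul_assoc]
    refine mul_le_mul_of_nonneg_left ?_ (by positivity)
    refine (norm_add₃_le).trans ?_
    rw [norm_mul, norm_mul, mul_add, mul_add]
    gcongr
    · exact norm_inv_one_sub_walshRoot_pow hb hκ0 hκ
    · exact norm_half_sub_inv_one_sub_walshRoot_pow hb hκ0 hκ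
  have hlim : Filter.Tendsto (fun N : ℕ => rootGap b * ((b : ℝ) ^ (n + 1))⁻¹ *
      (‖L (walshFun hb m)‖ + ‖L (walshFun hb k)‖ + E / ((b : ℝ) + 1)) + K * ((b : ℝ) ^ N)⁻¹)
      Filter.atTop (nhds (rootGap b * ((b : ℝ) ^ (n + 1))⁻¹ * (‖L (walshFun hb m)‖ +
        ‖L (walshFun hb k)‖ + E / ((b : ℝ) + 1)) + K * 0)) := by
    refine Filter.Tendsto.const_add _ (Filter.Tendsto.const_mul _ ?_)
    exact tendsto_inv_atTop_zero.comp (tendsto_pow_atTop_atTop_of_one_lt (by linarith))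
  rw [mul_zero, add_zero] at hlim
  refine ge_of_tendsto' hlim fun N => ?_
  calc ‖L (centredPrimitive (walshFun hb k))‖ =
        ‖L (P N) + L (centredPrimitive (walshFun hb k) - P N)‖ := by
        rw [← map_add, add_sub_cancel]
    _ ≤ _ := (norm_add_le _ _).trans (add_le_add (hmain N) (hrem N))

/-! ### Bounds for iterated primitives of Walsh functions -/

/-- The factor `1 + 1 / b + 1 / (b (b + 1))` by which the constant in the bounds grows with each
integration. -/
noncomputable def stepFactor (b : ℕ) : ℝ := 1 + 1 / (b : ℝ) + 1 / ((b : ℝ) * ((b : ℝ) + 1))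

theorem stepFactor_pos {b : ℕ} : 0 < stepFactor b := by
  rw [stepFactor]
  positivity

theorem stepFactor_le {b : ℕ} (hb : 2 ≤ b) : stepFactor b ≤ 5 / 3 := by
  have hb' : (2 : ℝ) ≤ b := by exact_mod_cast hb
  have h1 : 1 / (b : ℝ) ≤ 1 / 2 := by gcongr
  have h2 : 1 / ((b : ℝ) * ((b : ℝ) + 1)) ≤ 1 / (2 * (2 + 1)) := by gcongr
  rw [stepFactor]
  linarith

/-- The effect of one integration on a decay of order `b ^ (-μ_{s,per}(k))` with `s ≥ 1`. -/
theorem norm_apply_centredPrimitive_le_of_muPer {b : ℕ} (hb : 2 ≤ b) {L : locInt →ₗ[ℂ] ℂ}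
    (hL : SupBounded L) (hL0 : L (walshFun hb 0) = 0) {D : ℝ} (hD : 0 ≤ D) (s : ℕ)
    (hdecay : ∀ k, k ≠ 0 → ‖L (walshFun hb k)‖ ≤ D * ((b : ℝ) ^ muPer b (s + 1) k)⁻¹)
    {k : ℕ} (hk : k ≠ 0) :
    ‖L (centredPrimitive (walshFun hb k))‖ ≤
      rootGap b * stepFactor b * D * ((b : ℝ) ^ muPer b (s + 2) k)⁻¹ := by
  have hb' : (2 : ℝ) ≤ b := by exact_mod_cast hb
  have hb1 : (1 : ℝ) ≤ b := by linarith
  have hM := (rootGap_pos hb).le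
  obtain ⟨κ, n, m, h0, h1, h2, rfl⟩ := exists_lead hb hk
  have hlt := lead_lt_pow h1 h2
  have hmono := muPer_succ_le hb (κ * b ^ n + m) (n + 1)
  have hE : ∀ c θ : ℕ, 0 < θ → θ < b →
      ‖L (walshFun hb (θ * b ^ (n + 1 + c) + (κ * b ^ n + m)))‖ ≤
        D * ((b : ℝ) ^ (n + 1 + muPer b s (κ * b ^ n + m)))⁻¹ * ((b : ℝ) ^ (c + 1))⁻¹ := by
    intro c θ hθ0 hθ1
    refine (hdecay _ (lead_ne_zero hθ0 hθ1)).trans_eq ?_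
    rw [muPer_lead hb hθ0 hθ1
      (hlt.trans_le (Nat.pow_le_pow_right (by omega) (by omega))) hk, mul_assoc, ← mul_inv,
      ← pow_add]
    congr 3
    ring
  refine (norm_apply_centredPrimitive_walshFun_le hb h0 h1 h2 hL (by positivity) hE).trans ?_
  have hkey : ‖L (walshFun hb m)‖ + ‖L (walshFun hb (κ * b ^ n + m))‖ +
      D * ((b : ℝ) ^ (n + 1 + muPer b s (κ * b ^ n + m)))⁻¹ / ((b : ℝ) + 1) ≤
      D * stepFactor b * ((b : ℝ) ^ (n + 1) * ((b : ℝ) ^ muPer b (s + 2) (κ * b ^ n + m))⁻¹) := by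
    rcases eq_or_ne m 0 with rfl | hm0
    · have e1 : ‖L (walshFun hb (κ * b ^ n + 0))‖ ≤
          D * ((b : ℝ) ^ (n + 1) * ((b : ℝ) ^ muPer b (s + 2) (κ * b ^ n + 0))⁻¹) := by
        refine (hdecay _ hk).trans_eq ?_
        rw [muPer_lead_zero hb h0 h1, muPer_lead_zero hb h0 h1,
          show (s + 2) * (n + 1) = (s + 1) * (n + 1) + (n + 1) by ring,
          pow_add _ _ (n + 1), mul_inv]
        field_simp
      have e2 : ((b : ℝ) ^ (n + 1 + muPer b s (κ * b ^ n + 0)))⁻¹ =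
          (b : ℝ) ^ (n + 1) * ((b : ℝ) ^ muPer b (s + 2) (κ * b ^ n + 0))⁻¹ := by
        rw [muPer_lead_zero hb h0 h1, muPer_lead_zero hb h0 h1,
          show (s + 2) * (n + 1) = (n + 1 + s * (n + 1)) + (n + 1) by ring,
          pow_add _ (n + 1 + s * (n + 1)), mul_inv]
        field_simp
      rw [hL0, norm_zero, zero_add, e2]
      set X := (b : ℝ) ^ (n + 1) * ((b : ℝ) ^ muPer b (s + 2) (κ * b ^ n + 0))⁻¹ with hX
      have hX0 : 0 ≤ X := by positivity
      have hfac : 1 + 1 / ((b : ℝ) + 1) ≤ stepFactor b := by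
        have : stepFactor b = 1 + 1 / ((b : ℝ) + 1) +
            2 / ((b : ℝ) * ((b : ℝ) + 1)) := by
          rw [stepFactor]
          field_simp
          ring
        rw [this]
        have : 0 ≤ 2 / ((b : ℝ) * ((b : ℝ) + 1)) := by positivity
        linarith
      calc _ ≤ D * X + D * X / ((b : ℝ) + 1) := by gcongr
        _ = D * (1 + 1 / ((b : ℝ) + 1)) * X := by ring
        _ ≤ _ := by gcongr
    · have hX1 : ((b : ℝ) ^ muPer b (s + 1) m)⁻¹ =
          (b : ℝ) ^ (n + 1) * ((b : ℝ) ^ muPer b (s + 2) (κ * b ^ n + m))⁻¹ := by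
        rw [muPer_lead hb h0 h1 h2 hm0, pow_add _ (n + 1) (muPer b (s + 1) m), mul_inv]
        field_simp
      rw [← hX1]
      set X := ((b : ℝ) ^ muPer b (s + 1) m)⁻¹ with hX
      have hX0 : 0 ≤ X := by positivity
      -- Two nonzero digits: the increments of `muPer` are now smaller than `n + 1`.
      have hexp : muPer b (s + 1) m + 1 ≤ muPer b (s + 1) (κ * b ^ n + m) := by
        have a1 := muPer_succ_le_of_lead hb h0 h1 h2 hm0 s
        rw [muPer_lead hb h0 h1 h2 hm0 (s + 1)] at a1
        omega
      have e1 : ((b : ℝ) ^ muPer b (s + 1) (κ * b ^ n + m))⁻¹ ≤ X * (1 / b) := by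
        rw [hX, one_div, ← mul_inv, ← pow_succ]
        exact inv_anti₀ (by positivity) (pow_le_pow_right₀ hb1 hexp)
      have e2 : ((b : ℝ) ^ (n + 1 + muPer b s (κ * b ^ n + m)))⁻¹ ≤ X * (1 / b) := by
        refine (inv_anti₀ (by positivity) (pow_le_pow_right₀ hb1 ?_)).trans e1
        have := hmono s hk hlt
        omega
      calc _ ≤ D * X + D * (X * (1 / b)) + D * (X * (1 / b)) / ((b : ℝ) + 1) := by
            gcongr
            · exact hdecay m hm0
            · refine (hdecay _ hk).trans ?_
              gcongr
        _ = _ := by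
            rw [stepFactor]
            field_simp
  calc _ ≤ rootGap b * ((b : ℝ) ^ (n + 1))⁻¹ * (D * stepFactor b *
        ((b : ℝ) ^ (n + 1) * ((b : ℝ) ^ muPer b (s + 2) (κ * b ^ n + m))⁻¹)) := by gcongr
    _ = _ := by field_simp

theorem pow_succ_centredPrimitive_walshFun_zero {b : ℕ} (hb : 2 ≤ b) (s : ℕ) :
    (centredPrimitive ^ (s + 1)) (walshFun hb 0) = 0 := by
  rw [pow_succ, Module.End.mul_apply, centredPrimitive_walshFun_zero, map_zero]

/-- The mean of the `s`-fold primitive is, up to sign, the Walsh coefficient of a polynomial of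
degree `s`; it vanishes if the Walsh index has more than `s` nonzero digits. -/
theorem meanUnit_pow_centredPrimitive_eq_zero {b : ℕ} (hb : 2 ≤ b) (s : ℕ) :
    ∀ k, s < numNonzeroDigits b k →
      meanUnit ((centredPrimitive ^ s) (walshFun hb k)) = 0 := by
  induction s with
  | zero =>
    intro k hk
    refine meanUnit_walshFun hb ?_
    rintro rfl
    simp [numNonzeroDigits_zero] at hk
  | succ s ih =>
    intro k hk
    have hk0 : k ≠ 0 := by
      rintro rfl
      simp [numNonzeroDigits_zero] at hk
    obtain ⟨κ, n, m, h0, h1, h2, rfl⟩ := exists_lead hb hk0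
    have hm := hk
    rw [numNonzeroDigits_lead hb h0 h1 h2] at hm
    have h := norm_apply_centredPrimitive_walshFun_le hb h0 h1 h2
      (supBounded_meanUnit.comp_pow s) le_rfl (fun c θ hθ0 hθ1 => by
        rw [LinearMap.comp_apply, ih _ ?_, norm_zero, zero_mul]
        rw [numNonzeroDigits_lead hb hθ0 hθ1
          ((lead_lt_pow h1 h2).trans_le (Nat.pow_le_pow_right (by omega) (by omega)))]
        omega)
    simp only [LinearMap.comp_apply] at h
    rw [ih m (by omega), ih _ (by omega), norm_zero, zero_div, add_zero, add_zero, mul_zero] at h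
    rw [pow_succ, Module.End.mul_apply]
    exact norm_le_zero_iff.1 h

theorem muPer_one_lead {b κ n m : ℕ} (hb : 2 ≤ b) (hκ0 : 0 < κ) (hκ : κ < b)
    (hm : m < b ^ n) : muPer b 1 (κ * b ^ n + m) = n + 1 := by
  rcases eq_or_ne m 0 with rfl | hm0
  · rw [muPer_lead_zero hb hκ0 hκ, one_mul]
  · rw [muPer_lead hb hκ0 hκ hm hm0, muPer_zero_left]

theorem numNonzeroDigits_pos {b k : ℕ} (hb : 2 ≤ b) (hk : k ≠ 0) : 0 < numNonzeroDigits b k := by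
  obtain ⟨κ, n, m, h0, h1, h2, rfl⟩ := exists_lead hb hk
  rw [numNonzeroDigits_lead hb h0 h1 h2]
  omega

theorem norm_meanUnit_centredPrimitive_le {b k : ℕ} (hb : 2 ≤ b) (hk : k ≠ 0) :
    ‖meanUnit (centredPrimitive (walshFun hb k))‖ ≤ rootGap b * ((b : ℝ) ^ muPer b 1 k)⁻¹ := by
  have hM := (rootGap_pos hb).le
  obtain ⟨κ, n, m, h0, h1, h2, rfl⟩ := exists_lead hb hk
  have h := norm_apply_centredPrimitive_walshFun_le hb h0 h1 h2
    supBounded_meanUnit le_rfl (fun c θ hθ0 hθ1 => by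
      rw [meanUnit_walshFun hb (lead_ne_zero hθ0 hθ1), norm_zero, zero_mul])
  rw [meanUnit_walshFun hb hk, norm_zero, zero_div, add_zero, add_zero] at h
  rw [muPer_one_lead hb h0 h1 h2]
  refine h.trans (mul_le_of_le_one_right (by positivity) ?_)
  rcases eq_or_ne m 0 with rfl | hm0
  · rw [meanUnit_walshFun_zero, norm_one]
  · rw [meanUnit_walshFun hb hm0, norm_zero]
    exact zero_le_one

/-- The second primitive loses no factor `stepFactor b`: of the three contributions to its mean,
only one is nonzero. -/
theorem norm_meanUnit_centredPrimitive_sq_le {b k : ℕ} (hb : 2 ≤ b) (hk : k ≠ 0) :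
    ‖meanUnit ((centredPrimitive ^ 2) (walshFun hb k))‖ ≤
      rootGap b ^ 2 * ((b : ℝ) ^ muPer b 2 k)⁻¹ := by
  have hM := (rootGap_pos hb).le
  obtain ⟨κ, n, m, h0, h1, h2, rfl⟩ := exists_lead hb hk
  have hvan := meanUnit_pow_centredPrimitive_eq_zero hb 1
  simp only [pow_one] at hvan
  have h := norm_apply_centredPrimitive_walshFun_le hb h0 h1 h2
    supBounded_meanUnit.comp_centredPrimitive le_rfl (fun c θ hθ0 hθ1 => by
      rw [LinearMap.comp_apply, hvan _ ?_, norm_zero, zero_mul]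
      rw [numNonzeroDigits_lead hb hθ0 hθ1
          ((lead_lt_pow h1 h2).trans_le (Nat.pow_le_pow_right (by omega) (by omega)))]
      have := numNonzeroDigits_pos hb hk
      omega)
  simp only [LinearMap.comp_apply, zero_div, add_zero] at h
  rw [sq centredPrimitive, Module.End.mul_apply]
  refine h.trans ?_
  rcases eq_or_ne m 0 with rfl | hm0
  · have e := norm_meanUnit_centredPrimitive_le hb hk
    rw [muPer_one_lead hb h0 h1 h2] at e
    rw [centredPrimitive_walshFun_zero, map_zero, norm_zero, zero_add, muPer_lead_zero hb h0 h1,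
      two_mul, pow_add _ (n + 1) (n + 1), mul_inv]
    calc _ ≤ rootGap b * ((b : ℝ) ^ (n + 1))⁻¹ * (rootGap b * ((b : ℝ) ^ (n + 1))⁻¹) := by gcongr
      _ = _ := by ring
  · have e := norm_meanUnit_centredPrimitive_le hb hm0
    rw [hvan (κ * b ^ n + m) (by
      rw [numNonzeroDigits_lead hb h0 h1 h2]
      have := numNonzeroDigits_pos hb hm0
      omega), norm_zero, add_zero, muPer_lead hb h0 h1 h2 hm0,
      pow_add _ (n + 1) (muPer b 1 m), mul_inv]
    calc _ ≤ rootGap b * ((b : ℝ) ^ (n + 1))⁻¹ * (rootGap b * ((b : ℝ) ^ muPer b 1 m)⁻¹) := by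
          gcongr
      _ = _ := by ring

theorem norm_meanUnit_pow_centredPrimitive_le {b : ℕ} (hb : 2 ≤ b) (s : ℕ) :
    ∀ k, k ≠ 0 → ‖meanUnit ((centredPrimitive ^ (s + 2)) (walshFun hb k))‖ ≤
      rootGap b ^ (s + 2) * stepFactor b ^ s * ((b : ℝ) ^ muPer b (s + 2) k)⁻¹ := by
  have hM := (rootGap_pos hb).le
  have hC := (stepFactor_pos (b := b)).le
  induction s with
  | zero =>
    intro k hk
    simpa using norm_meanUnit_centredPrimitive_sq_le hb hk
  | succ s ih =>
    intro k hk
    have h := norm_apply_centredPrimitive_le_of_muPer hb (supBounded_meanUnit.comp_pow (s + 2))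
      (by rw [LinearMap.comp_apply, pow_succ_centredPrimitive_walshFun_zero, map_zero])
      (by positivity) (s + 1) ih hk
    rw [show s + 1 + 2 = (s + 2) + 1 by ring, pow_succ centredPrimitive, Module.End.mul_apply]
    refine h.trans_eq ?_
    rw [show s + 1 + 2 = s + 2 + 1 by ring]
    ring

/-- The oscillation of the first primitive, bounded from its closed form: its values contribute
`3` and its mean contributes `1` to the constant `4`. -/
theorem norm_centredPrimitive_sub_mean_le {b k : ℕ} (hb : 2 ≤ b) (hk : k ≠ 0) {y : ℝ}
    (hy : y ∈ Icc (0 : ℝ) 1) :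
    ‖(evalAt y - meanUnit) (centredPrimitive (walshFun hb k))‖ ≤
      4 * rootGap b * ((b : ℝ) ^ muPer b 1 k)⁻¹ := by
  have hmean := norm_meanUnit_centredPrimitive_le hb hk
  have hM1 := one_le_two_mul_rootGap hb
  obtain ⟨κ, n, m, h0, h1, h2, rfl⟩ := exists_lead hb hk
  rw [muPer_one_lead hb h0 h1 h2] at hmean ⊢
  have hval : ‖evalAt y (centredPrimitive (walshFun hb (κ * b ^ n + m)))‖ ≤
      ((b : ℝ) ^ (n + 1))⁻¹ * (3 * rootGap b) := by
    rw [evalAt_apply, centredPrimitive_walshFun hb hk, integral_conjWalsh hb h0 h1 h2 hy.1,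
      norm_mul, norm_inv, norm_pow, Complex.norm_natCast]
    gcongr
    refine (norm_add_le _ _).trans ?_
    rw [norm_mul, norm_mul, norm_conjWalsh hb, norm_conjWalsh hb, mul_one, mul_one, add_sub_assoc]
    have e1 := norm_inv_one_sub_walshRoot_pow hb h0 h1
    have e2 := norm_half_sub_inv_one_sub_walshRoot_pow hb h0 h1
    have e3 : ‖((sawtooth (y * (b : ℝ) ^ (n + 1)) : ℝ) : ℂ)‖ ≤ 1 / 2 := by
      rw [Complex.norm_real]
      exact abs_sawtooth_le (mul_nonneg hy.1 (by positivity))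
    have e4 := norm_add_le ((sawtooth (y * (b : ℝ) ^ (n + 1)) : ℝ) : ℂ)
      (1 / 2 - (1 - walshRoot b ^ κ)⁻¹)
    linarith
  rw [LinearMap.sub_apply]
  calc _ ≤ ((b : ℝ) ^ (n + 1))⁻¹ * (3 * rootGap b) + rootGap b * ((b : ℝ) ^ (n + 1))⁻¹ :=
        (norm_sub_le _ _).trans (add_le_add hval hmean)
    _ = _ := by ring

/-- Unlike the mean, the oscillation picks up the factor `stepFactor b` from the second step on. -/
theorem norm_pow_centredPrimitive_sub_mean_le {b : ℕ} (hb : 2 ≤ b) {y : ℝ}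
    (hy : y ∈ Icc (0 : ℝ) 1) (s : ℕ) :
    ∀ k, k ≠ 0 → ‖(evalAt y - meanUnit) ((centredPrimitive ^ (s + 1)) (walshFun hb k))‖ ≤
      4 * rootGap b ^ (s + 1) * stepFactor b ^ s * ((b : ℝ) ^ muPer b (s + 1) k)⁻¹ := by
  have hM := (rootGap_pos hb).le
  have hC := (stepFactor_pos (b := b)).le
  induction s with
  | zero =>
    intro k hk
    simpa using norm_centredPrimitive_sub_mean_le hb hk hy
  | succ s ih =>
    intro k hk
    have h := norm_apply_centredPrimitive_le_of_muPer hb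
      (((supBounded_evalAt hy).sub supBounded_meanUnit).comp_pow (s + 1))
      (by rw [LinearMap.comp_apply, pow_succ_centredPrimitive_walshFun_zero, map_zero])
      (by positivity) s ih hk
    rw [pow_succ centredPrimitive, Module.End.mul_apply]
    refine h.trans_eq ?_
    ring

/-! ### Integration by parts in the Sobolev space -/

/-- Integration by parts for an absolutely continuous function and an integrable complex one. -/
theorem integral_smul_eq_sub_of_absolutelyContinuous {f : ℝ → ℝ} {g : ℝ → ℂ} {x y : ℝ}
    (hf : AbsolutelyContinuousOnInterval f x y) (hg : IntervalIntegrable g volume x y) :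
    ∫ t in x..y, f t • g t =
      f y • (∫ t in x..y, g t) - ∫ t in x..y, deriv f t • ∫ u in x..t, g u := by
  have hV : ContinuousOn (fun t => ∫ u in x..t, g u) (uIcc x y) :=
    intervalIntegral.continuousOn_primitive_interval' hg left_mem_uIcc
  have hfg : IntervalIntegrable (fun t => f t • g t) volume x y :=
    hg.continuousOn_smul hf.continuousOn
  have hdV : IntervalIntegrable (fun t => deriv f t • ∫ u in x..t, g u) volume x y :=
    hf.intervalIntegrable_deriv.smul_continuousOn hV
  -- It suffices to compare the images under the real and the imaginary part.
  have key : ∀ T : ℂ →L[ℝ] ℝ, T (∫ t in x..y, f t • g t) =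
      T (f y • (∫ t in x..y, g t) - ∫ t in x..y, deriv f t • ∫ u in x..t, g u) := by
    intro T
    have hTg : IntervalIntegrable (fun t => T (g t)) volume x y :=
      ⟨T.integrable_comp hg.1, T.integrable_comp hg.2⟩
    have hTV : ∀ t ∈ uIcc x y, T (∫ u in x..t, g u) = ∫ u in x..t, T (g u) := fun t ht =>
      (T.intervalIntegral_comp_comm (hg.mono_set (uIcc_subset_uIcc_left ht))).symm
    have hAC := hTg.absolutelyContinuousOnInterval_intervalIntegral (c := x) left_mem_uIcc
    have hparts := hf.integral_mul_deriv_eq_deriv_mul hAC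
    have hderiv : ∫ t in x..y, f t * deriv (fun t => ∫ u in x..t, T (g u)) t =
        ∫ t in x..y, f t * T (g t) := by
      refine intervalIntegral.integral_congr_ae ?_
      filter_upwards [hTg.ae_hasDerivAt_integral] with t ht htm
      rw [(ht (uIoc_subset_uIcc htm) x left_mem_uIcc).deriv]
    rw [hderiv, intervalIntegral.integral_same, mul_zero, sub_zero] at hparts
    rw [map_sub, map_smul, ← T.intervalIntegral_comp_comm hfg, ← T.intervalIntegral_comp_comm hdV,
      hTV y right_mem_uIcc]
    simp only [map_smul, smul_eq_mul]
    rw [hparts]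
    congr 1
    refine intervalIntegral.integral_congr fun t ht => ?_
    simp only [hTV t ht]
  exact Complex.ext (key Complex.reCLM) (key Complex.imCLM)

theorem integral_smul_sub_mean {f : ℝ → ℝ} (hf : IntervalIntegrable f volume 0 1) (h : locInt)
    (hfh : IntervalIntegrable (fun t => f t • (h : ℝ → ℂ) t) volume 0 1) :
    ∫ t in (0 : ℝ)..1, f t • ((h : ℝ → ℂ) t - meanUnit h) =
      (∫ t in (0 : ℝ)..1, f t • (h : ℝ → ℂ) t) - (∫ t in (0 : ℝ)..1, f t) • meanUnit h := by
  have hc : IntervalIntegrable (fun t => f t • meanUnit h) volume 0 1 := by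
    simpa only [Complex.real_smul] using
      (IntervalIntegrable.mul_const (show IntervalIntegrable (fun t => (f t : ℂ)) volume 0 1 from
        ⟨hf.1.ofReal, hf.2.ofReal⟩) (meanUnit h))
  simp only [smul_sub]
  rw [intervalIntegral.integral_sub hfh hc, intervalIntegral.integral_smul_const]

theorem integral_smul_eq_mean_sub {f : ℝ → ℝ} (hf : AbsolutelyContinuousOnInterval f 0 1)
    (h : locInt) :
    ∫ t in (0 : ℝ)..1, f t • (h : ℝ → ℂ) t =
      (∫ t in (0 : ℝ)..1, f t) • meanUnit h -
        ∫ t in (0 : ℝ)..1, deriv f t • (centredPrimitive h : ℝ → ℂ) t := by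
  have h1 := integral_smul_eq_sub_of_absolutelyContinuous hf
    (g := fun t => (h : ℝ → ℂ) t - meanUnit h) ((h.2 0 1).sub intervalIntegrable_const)
  have h2 : ∀ x : ℝ, ∫ t in (0 : ℝ)..x, ((h : ℝ → ℂ) t - meanUnit h) =
      (centredPrimitive h : ℝ → ℂ) x := by
    intro x
    rw [intervalIntegral.integral_sub (h.2 0 x) intervalIntegrable_const,
      intervalIntegral.integral_const, sub_zero, Complex.real_smul, centredPrimitive_apply]
  simp only [h2, centredPrimitive_one, smul_zero, zero_sub] at h1
  rw [integral_smul_sub_mean hf.continuousOn.intervalIntegrable h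
    ((h.2 0 1).continuousOn_smul hf.continuousOn)] at h1
  linear_combination h1

theorem MemSobolev.absolutelyContinuous_unitDeriv {r : ℕ} {f : ℝ → ℝ} (hf : MemSobolev r f)
    {s : ℕ} (hs : s < r) : AbsolutelyContinuousOnInterval (unitDeriv s f) 0 1 := by
  rcases Nat.eq_or_lt_of_le (Nat.le_sub_one_of_lt hs) with h | h
  · rw [h]
    exact hf.absolutelyContinuous
  · have h1 : ContDiffOn ℝ ((s + 1 : ℕ) : WithTop ℕ∞) f (Icc 0 1) :=
      hf.contDiffOn.of_le (by exact_mod_cast h)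
    have hu : UniqueDiffOn ℝ (Icc (0 : ℝ) 1) := uniqueDiffOn_Icc zero_lt_one
    have h2 := ((contDiffOn_nat_succ_iff_contDiffOn_one_iteratedDerivWithin hu).1
      (by exact_mod_cast h1)).2
    refine ContDiffOn.absolutelyContinuousOnInterval ?_
    rw [uIcc_of_le zero_le_one]
    exact h2

theorem unitDeriv_succ_eq_deriv (s : ℕ) (f : ℝ → ℝ) {x : ℝ} (hx : x ∈ Ioo (0 : ℝ) 1) :
    unitDeriv (s + 1) f x = deriv (unitDeriv s f) x := by
  rw [unitDeriv, iteratedDerivWithin_succ, derivWithin_of_mem_nhds (Icc_mem_nhds hx.1 hx.2)]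
  rfl

/-- One integration by parts, moving a derivative from `f` to the integration operator. -/
theorem MemSobolev.integral_unitDeriv_smul {r : ℕ} {f : ℝ → ℝ} (hf : MemSobolev r f)
    {s : ℕ} (hs : s < r) (h : locInt) :
    ∫ t in (0 : ℝ)..1, unitDeriv s f t • (h : ℝ → ℂ) t =
      (∫ t in (0 : ℝ)..1, unitDeriv s f t) • meanUnit h -
        ∫ t in (0 : ℝ)..1, unitDeriv (s + 1) f t • (centredPrimitive h : ℝ → ℂ) t := by
  rw [integral_smul_eq_mean_sub (hf.absolutelyContinuous_unitDeriv hs)]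
  congr 1
  refine intervalIntegral.integral_congr_ae ?_
  filter_upwards [compl_mem_ae_iff.2 (measure_singleton (1 : ℝ))] with t ht htm
  rw [uIoc_of_le zero_le_one] at htm
  have hne : t ≠ 1 := ht
  rw [unitDeriv_succ_eq_deriv s f ⟨htm.1, lt_of_le_of_ne htm.2 hne⟩]

theorem MemSobolev.intervalIntegrable_unitDeriv {r : ℕ} {f : ℝ → ℝ} (hf : MemSobolev r f) :
    IntervalIntegrable (unitDeriv r f) volume 0 1 := by
  have h1 : IntegrableOn (unitDeriv r f) (Icc 0 1) volume :=
    hf.memLp.integrable (by norm_num)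
  rw [intervalIntegrable_iff_integrableOn_Icc_of_le zero_le_one]
  exact h1

/-- The Euler–Maclaurin type formula for a functional `f ↦ ∫₀¹ f h`. -/
theorem MemSobolev.integral_smul_eq_sum {r : ℕ} {f : ℝ → ℝ} (hf : MemSobolev r f) (h : locInt)
    {n : ℕ} (hn : n ≤ r) :
    ∫ t in (0 : ℝ)..1, f t • (h : ℝ → ℂ) t =
      ∑ s ∈ Finset.range n, (-1) ^ s *
        ((∫ t in (0 : ℝ)..1, unitDeriv s f t) • meanUnit ((centredPrimitive ^ s) h)) +
      (-1) ^ n * ∫ t in (0 : ℝ)..1,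
        unitDeriv n f t • ((centredPrimitive ^ n) h : ℝ → ℂ) t := by
  induction n with
  | zero => simp [unitDeriv, iteratedDerivWithin_zero]
  | succ n ih =>
    rw [ih (by omega), Finset.sum_range_succ, hf.integral_unitDeriv_smul (by omega),
      pow_succ' centredPrimitive, Module.End.mul_apply]
    ring

theorem MemSobolev.norm_integral_le {r : ℕ} {f : ℝ → ℝ} (hf : MemSobolev r f) (h : locInt)
    {K : ℝ} (hr : 0 < r) (hK : ∀ y ∈ Icc (0 : ℝ) 1,
      ‖(evalAt y - meanUnit) ((centredPrimitive ^ r) h)‖ ≤ K) :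
    ‖∫ t in (0 : ℝ)..1, f t • (h : ℝ → ℂ) t‖ ≤
      ∑ s ∈ Finset.range (r + 1),
        |∫ t in (0 : ℝ)..1, unitDeriv s f t| * ‖meanUnit ((centredPrimitive ^ s) h)‖ +
      (∫ t in (0 : ℝ)..1, |unitDeriv r f t|) * K := by
  have hint := hf.intervalIntegrable_unitDeriv
  set F := (centredPrimitive ^ r) h with hF
  have hcont : Continuous (F : ℝ → ℂ) := by
    obtain ⟨q, rfl⟩ : ∃ q, r = q + 1 := ⟨r - 1, by omega⟩
    rw [hF, pow_succ', Module.End.mul_apply]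
    exact (continuous_primitive_locInt _).sub (Complex.continuous_ofReal.mul continuous_const)
  have h1 := integral_smul_sub_mean hint F (hint.smul_continuousOn hcont.continuousOn)
  have h2 : ‖∫ t in (0 : ℝ)..1, unitDeriv r f t • ((F : ℝ → ℂ) t - meanUnit F)‖ ≤
      (∫ t in (0 : ℝ)..1, |unitDeriv r f t|) * K := by
    rw [← intervalIntegral.integral_mul_const]
    refine intervalIntegral.norm_integral_le_of_norm_le zero_le_one ?_ (hint.abs.mul_const K)
    refine Filter.Eventually.of_forall fun t ht => ?_
    rw [norm_smul, Real.norm_eq_abs]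
    gcongr
    exact hK t ⟨ht.1.le, ht.2⟩
  have h3 : ∫ t in (0 : ℝ)..1, unitDeriv r f t • (F : ℝ → ℂ) t =
      (∫ t in (0 : ℝ)..1, unitDeriv r f t) • meanUnit F +
        ∫ t in (0 : ℝ)..1, unitDeriv r f t • ((F : ℝ → ℂ) t - meanUnit F) := by
    rw [h1]
    ring
  rw [hf.integral_smul_eq_sum h le_rfl, ← hF, h3, mul_add, ← add_assoc, hF,
    ← Finset.sum_range_succ (fun s => (-1) ^ s *
      ((∫ t in (0 : ℝ)..1, unitDeriv s f t) • meanUnit ((centredPrimitive ^ s) h))) r]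
  refine (norm_add_le _ _).trans (add_le_add ?_ ?_)
  · refine (norm_sum_le _ _).trans (Finset.sum_le_sum fun s _ => ?_)
    rw [norm_mul, norm_pow, norm_neg, norm_one, one_pow, one_mul, norm_smul, Real.norm_eq_abs]
  · rw [norm_mul, norm_pow, norm_neg, norm_one, one_pow, one_mul]
    exact h2

/-! ### The bound for Walsh coefficients -/

theorem mainTheorem4 (b : ℕ) (hb : 2 ≤ b) (r : ℕ) (hr : 1 < r) (k : ℕ) (hk : 1 ≤ k)
    (f : ℝ → ℝ) (hf : MemSobolev r f) :
    ‖walshCoeff b f k‖ ≤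
      (∑ s ∈ Finset.Icc (numNonzeroDigits b k) r,
        |∫ x in (0 : ℝ)..1, unitDeriv s f x| *
          ((b : ℝ) ^ (-(muPer b s k : ℤ)) / (2 * Real.sin (Real.pi / b)) ^ s) *
          (1 + 1 / (b : ℝ) + 1 / ((b : ℝ) * ((b : ℝ) + 1))) ^ (max 0 ((s : ℤ) - 2))) +
      (∫ x in (0 : ℝ)..1, |unitDeriv r f x|) *
        (2 * (b : ℝ) ^ (-(muPer b r k : ℤ)) / (2 * Real.sin (Real.pi / b)) ^ r) *
        (1 + 1 / (b : ℝ) + 1 / ((b : ℝ) * ((b : ℝ) + 1))) ^ (r - 2) *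
        (3 + 2 / (b : ℝ) + (2 * (b : ℝ) + 1) / ((b : ℝ) - 1)) := by
  have hb' : (2 : ℝ) ≤ b := by exact_mod_cast hb
  have hk0 : k ≠ 0 := by omega
  have hM := (rootGap_pos hb).le
  have hC := (stepFactor_pos (b := b)).le
  have hroot : ∀ (j s : ℕ), (b : ℝ) ^ (-(j : ℤ)) / (2 * Real.sin (Real.pi / b)) ^ s =
      rootGap b ^ s * ((b : ℝ) ^ j)⁻¹ := by
    intro j s
    rw [zpow_neg, zpow_natCast, rootGap, one_div, inv_pow, div_eq_mul_inv, mul_comm]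
  have hcoeff : walshCoeff b f k = ∫ t in (0 : ℝ)..1, f t • (walshFun hb k : ℝ → ℂ) t := by
    simp only [Complex.real_smul]
    rfl
  obtain ⟨q, rfl⟩ : ∃ q, r = q + 2 := ⟨r - 2, by omega⟩
  rw [hcoeff]
  refine (hf.norm_integral_le (walshFun hb k) (by omega) fun y hy =>
    norm_pow_centredPrimitive_sub_mean_le hb hy (q + 1) k hk0).trans (add_le_add ?_ ?_)
  · have hsub : Finset.Icc (numNonzeroDigits b k) (q + 2) ⊆ Finset.range (q + 2 + 1) := by
      intro s hs
      rw [Finset.mem_Icc] at hs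
      rw [Finset.mem_range]
      omega
    rw [← Finset.sum_subset hsub]
    · refine Finset.sum_le_sum fun s hs => ?_
      rw [Finset.mem_Icc] at hs
      have hv := numNonzeroDigits_pos hb hk0
      rw [mul_assoc, hroot]
      refine mul_le_mul_of_nonneg_left ?_ (abs_nonneg _)
      obtain rfl | ⟨p, rfl⟩ : s = 1 ∨ ∃ p, s = p + 2 := by
        rcases Nat.lt_or_ge s 2 with h | h
        · exact Or.inl (by omega)
        · exact Or.inr ⟨s - 2, by omega⟩
      · have := norm_meanUnit_centredPrimitive_le hb hk0
        simpa using this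
      · have h1 : max 0 (((p + 2 : ℕ) : ℤ) - 2) = (p : ℤ) := by
          push_cast
          omega
        rw [h1, zpow_natCast]
        refine (norm_meanUnit_pow_centredPrimitive_le hb p k hk0).trans_eq ?_
        rw [stepFactor]
        ring
    · intro s hs1 hs2
      rw [Finset.mem_range] at hs1
      rw [Finset.mem_Icc] at hs2
      rw [meanUnit_pow_centredPrimitive_eq_zero hb s k (by omega), norm_zero, mul_zero]
  · have hnum : 4 * stepFactor b ≤
        2 * (3 + 2 / (b : ℝ) + (2 * (b : ℝ) + 1) / ((b : ℝ) - 1)) := by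
      have h1 := stepFactor_le hb
      have h2 : 0 ≤ 2 / (b : ℝ) := by positivity
      have h3 : 2 ≤ (2 * (b : ℝ) + 1) / ((b : ℝ) - 1) := by
        rw [le_div_iff₀ (by linarith)]
        linarith
      linarith
    have hI : 0 ≤ ∫ t in (0 : ℝ)..1, |unitDeriv (q + 2) f t| :=
      intervalIntegral.integral_nonneg zero_le_one fun _ _ => abs_nonneg _
    set I := ∫ t in (0 : ℝ)..1, |unitDeriv (q + 2) f t|
    rw [mul_assoc I, mul_assoc I]
    refine mul_le_mul_of_nonneg_left ?_ hI
    rw [mul_div_assoc, hroot, Nat.add_sub_cancel]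
    change _ ≤ 2 * (rootGap b ^ (q + 2) * ((b : ℝ) ^ muPer b (q + 2) k)⁻¹) * stepFactor b ^ q * _
    calc _ = rootGap b ^ (q + 2) * ((b : ℝ) ^ muPer b (q + 2) k)⁻¹ * stepFactor b ^ q *
          (4 * stepFactor b) := by ring
      _ ≤ rootGap b ^ (q + 2) * ((b : ℝ) ^ muPer b (q + 2) k)⁻¹ * stepFactor b ^ q *
          (2 * (3 + 2 / (b : ℝ) + (2 * (b : ℝ) + 1) / ((b : ℝ) - 1))) := by gcongr
      _ = _ := by ring
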